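/- **Setting.** Let $L$ be a real vector space (germs of solutions on a hypersurface $\Sigma$) with a symplectic form $\omega$ and a positive-definite complex structure $J$: $J^2=-1$, $\omega(J\phi,J\eta)=\omega(\phi,\eta)$ and $\omega(\phi,J\phi)>0$ for $\phi\neq 0$. Put $g(\phi,\eta)=2\omega(\phi,J\eta)$ and $\{\phi,\eta\}=g(\phi,\eta)+2\mathrm i\,\omega(\phi,\eta)$. Extend $\omega$ and $J$ complex linearly to $L^{\mathbb C}=L\oplus\mathrm iL$, let $L^\pm\subseteq L^{\mathbb C}$ be the eigenspaces of $J$ for the eigenvalues $\pm\mathrm i$, and let $P^\pm=\frac12(1\mp\mathrm iJ)$ be the projectors onto them. Let $\mathcal H$ be the Hilbert space of holomorphic wave functions $\psi\colon L\to\mathbb C$, i.e. the Hilbert space of functions on $L$ with reproducing kernel $\langle K_\phi,K_\xi\rangle=\exp(\frac12\{\xi,\phi\})$. It contains the coherent states $K_\xi(\phi)=\exp(\frac12\{\xi,\phi\})$, and $\psi(\phi)=\langle K_\phi,\psi\rangle$. A slice observable is a function $F\colon L^{\mathbb C}\to\mathbb C$ such that $z\mapsto F(a+zb)$ is entire for all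 $a,b\in L^{\mathbb C}$. **Quantization.** For $\xi\in L^{\mathbb C}$ let $D_\xi(\phi)=2\omega(\xi,\phi)$ and $G_\xi=\exp(\mathrm iD_\xi)$ (linear and Weyl observables). The slice region has boundary data $(\tau,\phi)\in L\oplus L$, the second copy having the opposite orientation (symplectic form $\omega\oplus(-\omega)$, complex structure $J\oplus(-J)$). Its interior solutions form the diagonal, and an observable $F$ has on $(\phi_1,\phi_2)$ the value $F(\frac12(\phi_1+\phi_2))$. For Weyl observables the correlation functions on the coherent states $K_\tau\otimes\iota(K_\phi)$ are $$\rho^{G_\xi}(K_\tau\otimes\iota(K_\phi))=\rho(K_\tau\otimes \iota(K_\phi))\;G_\xi(\widehat{(\tau,\phi)})\;\exp\big(\tfrac{\mathrm i}{2}D_\xi(\eta)\big).$$ Here $\widehat\zeta=\zeta^R-\mathrm i\zeta^I$ for the decomposition $\zeta=\zeta^R+(J\oplus(-J))\zeta^I$ of $\zeta=(\tau,\phi)$ with $\zeta^R,\zeta^I$ in the diagonal; $\rho(K_\tau\otimes\iota(K_\phi))=\exp(\frac14\{\zeta,\zeta\}_\partial-\frac{\mathrm i}2g_\partial(\zeta^R,\zeta^I)-\frac12g_\partial(\zeta^I,\zeta^I))$,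 where $g_\partial,\{\cdot,\cdot\}_\partial$ are formed from the boundary structures; and $\eta=(-P^+\xi,P^-\xi)$ is the unique solution with source $D_\xi$ in $L^+\oplus L^-$. Weyl observables generate the other observables, as follows. - For a product of linear observables, $\rho^{D_{\xi_1}\cdots D_{\xi_n}}=(-\mathrm i)^n\partial_{\lambda_1}\cdots\partial_{\lambda_n}\rho^{G_{\lambda_1\xi_1+\cdots+\lambda_n\xi_n}}|_{\lambda=0}$. - For a general observable $F$ and a finite-dimensional $J$-invariant subspace $V\subseteq L$, write each homogeneous Taylor component $F_n$ of $F$ at $0$, restricted to $V^{\mathbb C}$, as a finite linear combination of products of $n$ linear observables $D_\xi$ with $\xi\in V^{\mathbb C}$. Apply the previous rule linearly and sum over $n$ (unconditionally convergent). Then $\rho^F$ is the limit of the result along the set of all such $V$, directed by inclusion. $F$ is *quantizable* if this defines $\rho^F(K_\tau\otimes\iota(K_\phi))$ for all $\tau,\phi\in L$ and, for each $\phi$, $K_\tau\mapsto\rho^F(K_\tau\otimes\iota(K_\phi))$ extends (then uniquely) to a continuous linear functional $\psi\mapsto\rho^F(\psi\otimes\iota(K_\phi))$ on $\mathcal H$.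 For $\psi\in\mathcal H$ the function $\hat F\psi\colon L\to\mathbb C$ is then $$(\hat F\psi)(\phi)=\langle K_\phi,\hat F\psi\rangle=\rho^F(\psi\otimes\iota(K_\phi)).$$ As a (possibly unbounded) operator in $\mathcal H$, $\hat F$ has the domain $\{\psi\in\mathcal H:\hat F\psi\in\mathcal H\}$. **Proposition.** Let the slice observable $F$ be holomorphic with respect to $J$, i.e. $F(\phi)=F(\phi+\xi)$ for all $\phi\in L^{\mathbb C}$ and $\xi\in L^-$. Then $F$ is quantizable, with a unique $\hat F$, and $\hat F$ acts by multiplication of wave functions: $$(\hat F\psi)(\phi)=F(\phi)\,\psi(\phi)\qquad\text{for all }\psi\in\mathcal H,\ \phi\in L.$$ In particular, as an operator in $\mathcal H$, $\hat F$ is multiplication by $F$ on the maximal domain $\{\psi\in\mathcal H: F\psi\in\mathcal H\}$. -/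

import Mathlib

open scoped TensorProduct

noncomputable section

/-- The space of germs of solutions on a hypersurface: a real vector space `L` with a symplectic
form `ω` and a positive-definite complex structure `J`, i.e. a Kähler polarization. No completeness
and no finiteness of the dimension is required. Non-degeneracy of `ω` follows from `pos`. -/
structure KahlerPhaseSpace (L : Type*) [AddCommGroup L] [Module ℝ L] where
  /-- the symplectic form -/
  ω : LinearMap.BilinForm ℝ L
  /-- the complex structure -/
  J : L →ₗ[ℝ] L
  alt : ∀ x, ω x x = 0
  J_sq : ∀ x, J (J x) = -x
  compat : ∀ x y, ω (J x) (J y) = ω x y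
  pos : ∀ x, x ≠ 0 → 0 < ω x (J x)

/-- The complexification `L^ℂ = L ⊕ i L`. -/
abbrev Cx (L : Type*) [AddCommGroup L] [Module ℝ L] : Type _ := ℂ ⊗[ℝ] L

/-- The inclusion `L → L^ℂ` of the real elements. -/
def toCx {L : Type*} [AddCommGroup L] [Module ℝ L] (φ : L) : Cx L := (1 : ℂ) ⊗ₜ[ℝ] φ

/-- Holomorphic functions on a complex vector space (no topology): entire on every complex line. -/
def IsLineHolomorphic {V : Type*} [AddCommGroup V] [Module ℂ V] (f : V → ℂ) : Prop :=
  ∀ a b : V, Differentiable ℂ fun z : ℂ => f (a + z • b)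

theorem Cx.exists_re_im {L : Type*} [AddCommGroup L] [Module ℝ L] (x : Cx L) :
    ∃ a b : L, x = toCx a + Complex.I • toCx b := by
  induction x using TensorProduct.induction_on with
  | zero => exact ⟨0, 0, by simp [toCx]⟩
  | tmul z v =>
    refine ⟨z.re • v, z.im • v, ?_⟩
    simp only [toCx, TensorProduct.tmul_smul, TensorProduct.smul_tmul', ← TensorProduct.add_tmul]
    congr 1
    apply Complex.ext <;> simp
  | add x y hx hy =>
    obtain ⟨a, b, rfl⟩ := hx
    obtain ⟨c, d, rfl⟩ := hy
    refine ⟨a + c, b + d, ?_⟩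
    simp only [toCx, TensorProduct.tmul_add, smul_add]
    abel

namespace KahlerPhaseSpace

variable {L : Type*} [AddCommGroup L] [Module ℝ L] (S : KahlerPhaseSpace L)

theorem skew (x y : L) : S.ω x y = -S.ω y x := by
  have h := S.alt (x + y)
  simp only [map_add, LinearMap.add_apply, S.alt, zero_add, add_zero] at h
  linarith

theorem ω_J_comm (x y : L) : S.ω x (S.J y) = S.ω y (S.J x) := by
  rw [← S.compat x (S.J y), S.J_sq, map_neg, S.skew (S.J x) y, neg_neg]

/-- The real inner product `g(φ, η) = 2 ω(φ, J η)`. -/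
def g (φ η : L) : ℝ := 2 * S.ω φ (S.J η)

/-- The hermitian inner product `{φ, η} = 2 ω(φ, J η) + 2 i ω(φ, η)`; it is antilinear in the first
and linear in the second argument with respect to `J`. -/
def herm (φ η : L) : ℂ := (S.g φ η : ℂ) + 2 * Complex.I * (S.ω φ η : ℂ)

/-- The complex bilinear extension of `ω` to `L^ℂ`. -/
def ωC : LinearMap.BilinForm ℂ (Cx L) := S.ω.baseChange ℂ

/-- The complex linear extension of `J` to `L^ℂ`. -/
def JC : Cx L →ₗ[ℂ] Cx L := S.J.baseChange ℂ

/-- The polarization `L^+`, the `i`-eigenspace of `J` on `L^ℂ`. -/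
def Lplus : Submodule ℂ (Cx L) := Module.End.eigenspace S.JC Complex.I

/-- The conjugate polarization `L^-`, the `(-i)`-eigenspace of `J` on `L^ℂ`. -/
def Lminus : Submodule ℂ (Cx L) := Module.End.eigenspace S.JC (-Complex.I)

/-- The projector onto `L^+`. -/
def Pplus (φ : Cx L) : Cx L := (1 / 2 : ℂ) • (φ - Complex.I • S.JC φ)

/-- The projector onto `L^-`. -/
def Pminus (φ : Cx L) : Cx L := (1 / 2 : ℂ) • (φ + Complex.I • S.JC φ)

/-! ### The state space: Hilbert space of holomorphic wave functions on `L` -/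

theorem herm_conj (x y : L) : (starRingEnd ℂ) (S.herm x y) = S.herm y x := by
  apply Complex.ext
  · simp [herm, g, S.ω_J_comm x y]
  · simp [herm, g, S.skew x y]

/-- Multiplication of an element of `L` by a complex number, where `i` acts as `J`. -/
def cmul (c : ℂ) (x : L) : L := c.re • x + c.im • S.J x

theorem herm_add_left (x y z : L) : S.herm (x + y) z = S.herm x z + S.herm y z := by
  simp [herm, g]; ring

theorem herm_add_right (x y z : L) : S.herm x (y + z) = S.herm x y + S.herm x z := by
  simp [herm, g]; ring

theorem herm_cmul_right (c : ℂ) (x y : L) : S.herm x (S.cmul c y) = c * S.herm x y := by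
  apply Complex.ext
  · simp [herm, g, cmul, S.J_sq]; ring
  · simp [herm, g, cmul, S.J_sq]; ring

theorem herm_cmul_left (c : ℂ) (x y : L) :
    S.herm (S.cmul c x) y = (starRingEnd ℂ) c * S.herm x y := by
  rw [← S.herm_conj y, herm_cmul_right, map_mul, S.herm_conj]

theorem herm_self_re_nonneg (x : L) : 0 ≤ (S.herm x x).re := by
  by_cases h : x = 0
  · simp [h, herm, g]
  · have := S.pos x h
    simp [herm, g]; linarith

theorem herm_self (x : L) : S.herm x x = ((S.herm x x).re : ℂ) := by
  apply Complex.ext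
  · simp
  · simp [herm, S.alt]

theorem herm_sum_left {ι : Type*} (s : Finset ι) (f : ι → L) (y : L) :
    S.herm (∑ i ∈ s, f i) y = ∑ i ∈ s, S.herm (f i) y := by
  classical
  induction s using Finset.induction_on with
  | empty => simp [herm, g]
  | insert a s ha ih => rw [Finset.sum_insert ha, Finset.sum_insert ha, herm_add_left, ih]

theorem herm_sum_right {ι : Type*} (s : Finset ι) (f : ι → L) (y : L) :
    S.herm y (∑ i ∈ s, f i) = ∑ i ∈ s, S.herm y (f i) := by
  classical
  induction s using Finset.induction_on with
  | empty => simp [herm, g]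
  | insert a s ha ih => rw [Finset.sum_insert ha, Finset.sum_insert ha, herm_add_right, ih]

/-- The scalar kernel `(φ, ξ) ↦ exp({ξ, φ} / 2)`: the value at `φ` of the wave function of the
coherent state at `ξ`. -/
def cohScalar (φ ξ : L) : ℂ := Complex.exp (1 / 2 * S.herm ξ φ)

/-- The same kernel with values in operators on `ℂ`. -/
def cohKernel : Matrix L L (ℂ →L[ℂ] ℂ) :=
  Matrix.of fun φ ξ => S.cohScalar φ ξ • ContinuousLinearMap.id ℂ ℂ

open scoped ComplexOrder in
theorem herm_posSemidef : (Matrix.of fun i j => S.herm i j : Matrix L L ℂ).PosSemidef := by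
  refine ⟨?_, fun x => ?_⟩
  · ext i j
    simp [Matrix.conjTranspose_apply, S.herm_conj]
  · have h : (x.sum fun i xi => x.sum fun j xj =>
        star xi * (Matrix.of fun i j => S.herm i j : Matrix L L ℂ) i j * xj)
        = S.herm (∑ i ∈ x.support, S.cmul (x i) i) (∑ j ∈ x.support, S.cmul (x j) j) := by
      rw [herm_sum_left]
      refine Finset.sum_congr rfl fun i _ => ?_
      rw [herm_sum_right]
      refine Finset.sum_congr rfl fun j _ => ?_
      rw [herm_cmul_left, herm_cmul_right]
      simp only [Matrix.of_apply, Complex.star_def]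
      ring
    rw [h, herm_self]
    exact_mod_cast S.herm_self_re_nonneg _

open scoped ComplexOrder in
theorem herm_pow_posSemidef (n : ℕ) :
    (Matrix.of fun i j => S.herm i j ^ n : Matrix L L ℂ).PosSemidef := by
  induction n with
  | zero =>
    refine ⟨by ext i j; simp [Matrix.conjTranspose_apply], fun x => ?_⟩
    have h : (x.sum fun i xi => x.sum fun j xj =>
        star xi * (Matrix.of fun i j => S.herm i j ^ 0 : Matrix L L ℂ) i j * xj)
        = star (∑ i ∈ x.support, x i) * ∑ j ∈ x.support, x j := by
      rw [star_sum, Finset.sum_mul_sum]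
      simp [Finsupp.sum]
    rw [h]
    exact star_mul_self_nonneg _
  | succ n ih =>
    have h := ih.hadamard S.herm_posSemidef
    have e : (Matrix.of fun i j => S.herm i j ^ (n + 1) : Matrix L L ℂ)
        = Matrix.hadamard (Matrix.of fun i j => S.herm i j ^ n)
          (Matrix.of fun i j => S.herm i j) := by
      ext i j
      simp [Matrix.hadamard_apply, pow_succ]
    rw [e]
    exact h

open scoped ComplexOrder in
theorem exp_herm_nonneg (s : Finset L) (c : L → ℂ) :
    0 ≤ (∑ i ∈ s, ∑ j ∈ s, (starRingEnd ℂ) (c i) * c j *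
      Complex.exp (1 / 2 * S.herm i j)).re := by
  classical
  have hs : HasSum (fun n : ℕ => ∑ i ∈ s, ∑ j ∈ s, (starRingEnd ℂ) (c i) * c j *
      ((1 / 2 * S.herm i j) ^ n / (n.factorial : ℂ)))
      (∑ i ∈ s, ∑ j ∈ s, (starRingEnd ℂ) (c i) * c j * Complex.exp (1 / 2 * S.herm i j)) := by
    refine hasSum_sum fun i _ => hasSum_sum fun j _ => HasSum.mul_left _ ?_
    rw [Complex.exp_eq_exp_ℂ]
    exact NormedSpace.expSeries_div_hasSum_exp (𝔸 := ℂ) _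
  refine (Complex.hasSum_re hs).nonneg fun n => ?_
  have h := (S.herm_pow_posSemidef n).2 (Finsupp.onFinset s (fun i => if i ∈ s then c i else 0)
    (fun i hi => by by_contra h; simp [h] at hi))
  rw [Finsupp.onFinset_sum _ (by simp)] at h
  have e : ∀ i, ((Finsupp.onFinset s (fun i => if i ∈ s then c i else 0)
      (fun i hi => by by_contra h; simp [h] at hi)).sum fun j xj =>
        star (if i ∈ s then c i else 0) *
          (Matrix.of fun i j => S.herm i j ^ n : Matrix L L ℂ) i j * xj)
      = ∑ j ∈ s, star (if i ∈ s then c i else 0) * S.herm i j ^ n *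
          (if j ∈ s then c j else 0) := by
    intro i
    rw [Finsupp.onFinset_sum _ (by simp)]
    rfl
  simp only [e] at h
  have e2 : (∑ i ∈ s, ∑ j ∈ s, (starRingEnd ℂ) (c i) * c j *
      ((1 / 2 * S.herm i j) ^ n / (n.factorial : ℂ)))
      = (((1 / 2) ^ n / (n.factorial : ℝ) : ℝ) : ℂ) *
        ∑ i ∈ s, ∑ j ∈ s, star (if i ∈ s then c i else 0) * S.herm i j ^ n *
          (if j ∈ s then c j else 0) := by
    rw [Finset.mul_sum]
    refine Finset.sum_congr rfl fun i hi => ?_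
    rw [Finset.mul_sum]
    refine Finset.sum_congr rfl fun j hj => ?_
    simp only [hi, hj, if_true, mul_pow, Complex.star_def]
    push_cast
    ring
  rw [e2, Complex.re_ofReal_mul]
  exact mul_nonneg (by positivity) (Complex.nonneg_iff.mp h).1

open scoped ComplexOrder in
instance cohKernel_posSemidef : Fact S.cohKernel.PosSemidef := by
  have key := (RKHS.posSemidef_tfae (K := S.cohKernel)).out 0 2
  refine ⟨key.mpr ⟨?_, fun vv => ?_⟩⟩
  · ext i j
    simp only [Matrix.conjTranspose_apply, cohKernel, Matrix.of_apply, star_smul]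
    simp [cohScalar, ← Complex.exp_conj, S.herm_conj, ← ContinuousLinearMap.one_def, star_one,
      Complex.conj_ofNat]
  · have h := S.exp_herm_nonneg vv.support fun x => (starRingEnd ℂ) (vv x)
    rw [Finset.sum_comm] at h
    refine le_of_le_of_eq h ?_
    simp only [Finsupp.sum, RCLike.re_to_complex]
    congr 1
    refine Finset.sum_congr rfl fun x _ => Finset.sum_congr rfl fun x' _ => ?_
    simp only [cohKernel, cohScalar, Matrix.of_apply, smul_apply,
      ContinuousLinearMap.id_apply, smul_eq_mul, RCLike.inner_apply, map_mul, ← Complex.exp_conj,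
      S.herm_conj, map_div₀, map_one, Complex.conj_ofNat, Complex.conj_conj]
    ring

/-- The Hilbert space of states in the holomorphic representation: the completion of the span of
the coherent states, realised as a Hilbert space of wave functions `L → ℂ`, with reproducing kernel
`⟨K_φ, K_ξ⟩ = exp({ξ, φ} / 2)`. -/
abbrev StateSpace : Type _ := RKHS.OfKernel S.cohKernel

/-- The coherent state `K_ξ`. -/
def coh (ξ : L) : S.StateSpace := RKHS.kerFun S.StateSpace ξ 1

theorem coh_apply (ξ φ : L) : S.coh ξ φ = Complex.exp (1 / 2 * S.herm ξ φ) := by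
  rw [coh, RKHS.kerFun_apply, RKHS.OfKernel.kernel_ofKernel]
  simp [cohKernel, cohScalar]

/-- The reproducing property `ψ(φ) = ⟨K_φ, ψ⟩`. -/
theorem reproducing (φ : L) (ψ : S.StateSpace) : inner ℂ (S.coh φ) ψ = ψ φ := by
  rw [coh, RKHS.kerFun_inner]
  simp

/-! ### The slice region: boundary data and correlation functions of Weyl observables -/

/-- The boundary of the slice region consists of two copies of the hypersurface, the second one with
the opposite orientation: `L × L` with symplectic form `ω ⊕ (-ω)` and complex structure
`J ⊕ (-J)`. -/
def double : KahlerPhaseSpace (L × L) where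
  ω := S.ω.compl₁₂ (LinearMap.fst ℝ L L) (LinearMap.fst ℝ L L)
    - S.ω.compl₁₂ (LinearMap.snd ℝ L L) (LinearMap.snd ℝ L L)
  J := S.J.prodMap (-S.J)
  alt x := by simp [S.alt]
  J_sq x := by ext <;> simp [S.J_sq]
  compat x y := by simp [S.compat]
  pos x hx := by
    have h : ∀ y, 0 ≤ S.ω y (S.J y) := fun y => by
      by_cases hy : y = 0
      · simp [hy]
      · exact (S.pos y hy).le
    simp only [LinearMap.sub_apply, LinearMap.compl₁₂_apply, LinearMap.fst_apply,
      LinearMap.snd_apply, LinearMap.prodMap_apply, LinearMap.neg_apply, map_neg, sub_neg_eq_add]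
    by_cases h1 : x.1 = 0
    · have h2 : x.2 ≠ 0 := fun h2 => hx (Prod.ext h1 h2)
      have := S.pos _ h2
      have := h x.1
      linarith
    · have := S.pos _ h1
      have := h x.2
      linarith

/-- The solutions in the interior of the slice region: the diagonal of `L × L`. -/
def interior : Submodule ℝ (L × L) := LinearMap.range (LinearMap.id.prod LinearMap.id)

/-- The component `ζ^R` in the decomposition `ζ = ζ^R + J ζ^I` with `ζ^R`, `ζ^I` interior
solutions. -/
def partR (ζ : L × L) : L × L := ((1 / 2 : ℝ) • (ζ.1 + ζ.2), (1 / 2 : ℝ) • (ζ.1 + ζ.2))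

/-- The component `ζ^I` in the decomposition `ζ = ζ^R + J ζ^I` with `ζ^R`, `ζ^I` interior
solutions. -/
def partI (ζ : L × L) : L × L :=
  ((1 / 2 : ℝ) • S.J (ζ.2 - ζ.1), (1 / 2 : ℝ) • S.J (ζ.2 - ζ.1))

theorem eq_parts_iff (ζ a b : L × L) :
    (a ∈ interior ∧ b ∈ interior ∧ ζ = a + S.double.J b) ↔ a = partR ζ ∧ b = S.partI ζ := by
  constructor
  · rintro ⟨⟨x, rfl⟩, ⟨y, rfl⟩, rfl⟩
    refine ⟨?_, ?_⟩
    · ext <;> simp [partR, double] <;> module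
    · ext <;> simp [partI, double, S.J_sq] <;> module
  · rintro ⟨rfl, rfl⟩
    refine ⟨⟨_, rfl⟩, ⟨_, rfl⟩, ?_⟩
    ext
    · simp [partR, partI, double, S.J_sq]; module
    · simp [partR, partI, double, S.J_sq]; module

/-- The inclusion of the real boundary data into the complexified ones, `L^ℂ × L^ℂ`. -/
def toCx2 (ζ : L × L) : Cx L × Cx L := (toCx ζ.1, toCx ζ.2)

/-- The complexified interior solution `ζ^R - i ζ^I` determined by boundary data `ζ`. -/
def hat (ζ : L × L) : Cx L × Cx L := toCx2 (partR ζ) - Complex.I • toCx2 (S.partI ζ)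

/-- A slice observable is determined by a function `F` on `L^ℂ`; its value on a field configuration
in the slice region, an element of `L^ℂ × L^ℂ`, is the value of `F` on the average. -/
def onSlice (F : Cx L → ℂ) (x : Cx L × Cx L) : ℂ := F ((1 / 2 : ℂ) • (x.1 + x.2))

/-- The linear slice observable determined by `ξ`. -/
def linObs (ξ φ : Cx L) : ℂ := 2 * S.ωC ξ φ

/-- The Weyl slice observable determined by `ξ`. -/
def weylObs (ξ φ : Cx L) : ℂ := Complex.exp (Complex.I * S.linObs ξ φ)

/-- The complexified symplectic form on the boundary of the slice region. -/
def ωC2 (x y : Cx L × Cx L) : ℂ := S.ωC x.1 y.1 - S.ωC x.2 y.2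

/-- The complexified solutions in the slice region of the equations of motion with the linear
observable determined by `ξ` added to the action as a source. -/
def sourceSolutions (ξ : Cx L) : Set (Cx L × Cx L) :=
  {η | ∀ φ : Cx L, onSlice (S.linObs ξ) (φ, φ) = 2 * S.ωC2 (φ, φ) η}

/-- The polarization on the boundary of the slice region. On the oppositely oriented copy it is the
conjugate one. -/
def boundaryPolarization : Submodule ℂ (Cx L × Cx L) := S.Lplus.prod S.Lminus

/-- The solution with source `ξ` that satisfies the boundary conditions. -/
def vacuumSolution (ξ : Cx L) : Cx L × Cx L := (-S.Pplus ξ, S.Pminus ξ)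

theorem ωC_alt (x : Cx L) : S.ωC x x = 0 := by
  obtain ⟨a, b, rfl⟩ := Cx.exists_re_im x
  simp [ωC, toCx, S.alt, LinearMap.BilinForm.baseChange_tmul, S.skew a b]

theorem ωC_skew (x y : Cx L) : S.ωC x y = -S.ωC y x := by
  have h := S.ωC_alt (x + y)
  simp only [map_add, LinearMap.add_apply, S.ωC_alt, zero_add, add_zero] at h
  linear_combination h

theorem toCx_inj_aux {a : L} (h : ∀ c, S.ω c a = 0) : a = 0 := by
  by_contra ha
  have := S.pos a ha
  rw [S.skew, h] at this
  simp at this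

theorem ωC_nondeg {y : Cx L} (h : ∀ φ, S.ωC φ y = 0) : y = 0 := by
  obtain ⟨a, b, rfl⟩ := Cx.exists_re_im y
  have key : ∀ c, S.ω c a = 0 ∧ S.ω c b = 0 := by
    intro c
    have := h (toCx c)
    simp [ωC, toCx, LinearMap.BilinForm.baseChange_tmul] at this
    have h1 := congrArg Complex.re this
    have h2 := congrArg Complex.im this
    simp at h1 h2
    exact ⟨h1, h2⟩
  rw [S.toCx_inj_aux fun c => (key c).1, S.toCx_inj_aux fun c => (key c).2]
  simp [toCx]

theorem JC_JC (x : Cx L) : S.JC (S.JC x) = -x := by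
  obtain ⟨a, b, rfl⟩ := Cx.exists_re_im x
  simp [JC, toCx, S.J_sq, TensorProduct.tmul_neg]
  abel

theorem mem_Lplus {x : Cx L} : x ∈ S.Lplus ↔ S.JC x = Complex.I • x :=
  Module.End.mem_eigenspace_iff

theorem mem_Lminus {x : Cx L} : x ∈ S.Lminus ↔ S.JC x = -Complex.I • x :=
  Module.End.mem_eigenspace_iff

theorem eq_vacuumSolution_iff (ξ : Cx L) (η : Cx L × Cx L) :
    (η ∈ S.sourceSolutions ξ ∧ η ∈ S.boundaryPolarization) ↔ η = S.vacuumSolution ξ := by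
  have jump : η ∈ S.sourceSolutions ξ ↔ η.2 - η.1 = ξ := by
    constructor
    · intro h
      have : ∀ φ, S.ωC φ (η.2 - η.1 - ξ) = 0 := by
        intro φ
        have h1 := h φ
        simp only [onSlice, linObs, ωC2, ← two_smul ℂ φ, smul_smul] at h1
        norm_num at h1
        rw [map_sub, map_sub, S.ωC_skew φ ξ]
        rw [h1]
        ring
      exact sub_eq_zero.mp (S.ωC_nondeg this)
    · rintro rfl φ
      simp only [onSlice, linObs, ωC2, ← two_smul ℂ φ, smul_smul]
      norm_num
      rw [S.ωC_skew η.2 φ, S.ωC_skew η.1 φ]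
      ring
  rw [jump, boundaryPolarization, Submodule.mem_prod, mem_Lplus, mem_Lminus]
  constructor
  · rintro ⟨rfl, h1, h2⟩
    have hI : Complex.I * Complex.I = -1 := Complex.I_mul_I
    ext1
    · simp only [vacuumSolution, Pplus, map_sub, h1, h2, smul_sub, smul_smul, mul_neg, hI, neg_neg]
      module
    · simp only [vacuumSolution, Pminus, map_sub, h1, h2, smul_sub, smul_smul, mul_neg, hI,
        neg_neg]
      module
  · rintro rfl
    have hI : Complex.I * Complex.I = -1 := Complex.I_mul_I
    refine ⟨?_, ?_, ?_⟩
    · simp only [vacuumSolution, Pplus, Pminus]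
      module
    · simp only [vacuumSolution, Pplus, map_neg, map_smul, map_sub, JC_JC, smul_neg, smul_sub,
        smul_smul]
      match_scalars <;> first
        | ring1
        | linear_combination (1 / 2 : ℂ) * hI
        | linear_combination (-1 / 2 : ℂ) * hI
    · simp only [vacuumSolution, Pminus, map_add, map_smul, JC_JC, smul_neg, smul_add,
        smul_smul]
      match_scalars <;> first
        | ring1
        | linear_combination (1 / 2 : ℂ) * hI
        | linear_combination (-1 / 2 : ℂ) * hI

/-- The amplitude of the slice region on the (unnormalised) coherent state at `ζ`, i.e.
`exp({ζ, ζ} / 4)` times the amplitude of the normalised coherent state. -/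
def amplitude (ζ : L × L) : ℂ :=
  Complex.exp (1 / 4 * S.double.herm ζ ζ) *
    Complex.exp (-(Complex.I / 2) * S.double.g (partR ζ) (S.partI ζ)
      - 1 / 2 * S.double.g (S.partI ζ) (S.partI ζ))

/-- The correlation function of the slice region with the Weyl slice observable `F = exp(i D)`
determined by `ξ`, on the coherent state at `ζ`: the product of the amplitude, of the value of the
observable on the complexified interior solution and of the vacuum correlation function
`exp(i D(η) / 2)`. -/
def weylCorr (ζ : L × L) (ξ : Cx L) : ℂ :=
  S.amplitude ζ * onSlice (S.weylObs ξ) (S.hat ζ) *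
    Complex.exp (Complex.I / 2 * onSlice (S.linObs ξ) (S.vacuumSolution ξ))

/-! ### Correlation functions of general slice observables, generated by Weyl observables -/

/-- The correlation function with the product `D_1 ⋯ D_n` of the linear slice observables determined
by `ξ_1, …, ξ_n`, defined as
`(-i)^n ∂/∂λ_1 ⋯ ∂/∂λ_n` at `λ = 0` of the correlation function with the Weyl observable
`exp(i (λ_1 D_1 + ⋯ + λ_n D_n))`. -/
def prodCorr (ζ : L × L) {n : ℕ} (ξ : Fin n → Cx L) : ℂ :=
  (-Complex.I) ^ n *
    iteratedFDeriv ℝ n (fun t : Fin n → ℝ => S.weylCorr ζ (∑ k, (t k : ℂ) • ξ k)) 0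
      (fun k => Pi.single k 1)

/-- Finitely many modes: a finite-dimensional complex subspace of `(L, J)`. -/
abbrev FiniteModes : Type _ :=
  {V : Submodule ℝ L // FiniteDimensional ℝ V ∧ ∀ x ∈ V, S.J x ∈ V}

/-- The homogeneous component of degree `n` of a holomorphic function. -/
def homComponent (F : Cx L → ℂ) (n : ℕ) (φ : Cx L) : ℂ :=
  (n.factorial : ℂ)⁻¹ * iteratedDeriv n (fun z : ℂ => F (z • φ)) 0

/-- `r` is the correlation function, on the coherent state at `ζ`, with the degree `n` component of
`F` in the modes `V`: that component is a finite linear combination of products of `n` linear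
observables in these modes, and `r` is the linear combination of their correlation functions. -/
def IsHomCorr (F : Cx L → ℂ) (V : S.FiniteModes) (n : ℕ) (ζ : L × L) (r : ℂ) : Prop :=
  ∃ (N : ℕ) (c : Fin N → ℂ) (ξ : Fin N → Fin n → Cx L),
    (∀ j k, ξ j k ∈ V.1.baseChange ℂ) ∧
    (∀ φ ∈ V.1.baseChange ℂ, homComponent F n φ = ∑ j, c j * ∏ k, S.linObs (ξ j k) φ) ∧
    r = ∑ j, c j * S.prodCorr ζ (ξ j)

/-- `r` is the correlation function with `F` in the modes `V`: the sum over the degrees of the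
correlation functions with the homogeneous components. -/
def IsModeCorr (F : Cx L → ℂ) (V : S.FiniteModes) (ζ : L × L) (r : ℂ) : Prop :=
  ∃ s : ℕ → ℂ, (∀ n, S.IsHomCorr F V n ζ (s n)) ∧ HasSum s r

/-- `r` is the correlation function of the slice region with the slice observable `F` on the
coherent state at `ζ`: the limit, along the directed set of all finite sets of modes, of the
correlation functions in these modes. -/
def IsCorr (F : Cx L → ℂ) (ζ : L × L) (r : ℂ) : Prop :=
  ∃ s : S.FiniteModes → ℂ, (∀ᶠ V in Filter.atTop, S.IsModeCorr F V ζ (s V)) ∧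
    Filter.Tendsto s Filter.atTop (nhds r)

/-! ### The operator of a slice observable -/

/-- `T` assigns to every state `ψ` the wave function of `F̂ ψ`, given by
`(F̂ ψ)(φ) = ⟨K_φ, F̂ ψ⟩ = ρ^F(ψ ⊗ ι(K_φ))`. Here `ρ^F( · ⊗ ι(K_φ))` is the correlation function on
the coherent states, extended linearly and continuously to the whole state space. -/
structure IsQuantization (F : Cx L → ℂ) (T : S.StateSpace →ₗ[ℂ] (L → ℂ)) : Prop where
  corr : ∀ τ φ : L, S.IsCorr F (τ, φ) (T (S.coh τ) φ)
  continuous : ∀ φ : L, Continuous fun ψ => T ψ φ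

/-- The possibly unbounded operator on the state space given by `T`, on its maximal domain: all `ψ`
such that the function `T ψ` is the wave function of a state. -/
def toOperator (T : S.StateSpace →ₗ[ℂ] (L → ℂ)) : S.StateSpace →ₗ.[ℂ] S.StateSpace where
  domain :=
    { carrier := {ψ | ∃ χ : S.StateSpace, ∀ φ, χ φ = T ψ φ}
      add_mem' := by
        rintro a b ⟨x, hx⟩ ⟨y, hy⟩
        exact ⟨x + y, fun φ => by simp [hx, hy]⟩
      zero_mem' := ⟨0, fun φ => by simp⟩
      smul_mem' := by
        rintro c a ⟨x, hx⟩
        exact ⟨c • x, fun φ => by simp [hx]⟩ }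
  toFun :=
    { toFun := fun ψ => ψ.2.choose
      map_add' := by
        intro a b
        refine RKHS.ext fun φ => ?_
        have ha := a.2.choose_spec φ
        have hb := b.2.choose_spec φ
        have hab := (a + b).2.choose_spec φ
        simp only [RKHS.coe_add, Pi.add_apply]
        rw [ha, hb, hab]
        simp
      map_smul' := by
        intro c a
        refine RKHS.ext fun φ => ?_
        have ha := a.2.choose_spec φ
        have hca := (c • a).2.choose_spec φ
        simp only [RKHS.coe_smul, Pi.smul_apply, RingHom.id_apply]
        rw [ha, hca]
        simp }

theorem toOperator_apply (T : S.StateSpace →ₗ[ℂ] (L → ℂ)) (ψ : (S.toOperator T).domain) (φ : L) :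
    (S.toOperator T ψ : S.StateSpace) φ = T ψ φ :=
  ψ.2.choose_spec φ

end KahlerPhaseSpace

end

/-! ### Taylor coefficients along complex lines -/

/-! A function invariant under `L^-` sees only the `L^+` part of its argument. Since `L^+` and `L^-`
are isotropic for `ω`, replacing `ξ` by `P^- ξ` in a linear observable amounts to evaluating it on
`P^+` of the argument (`linObs_Pminus_left`). Each Taylor component of `F` is therefore a
combination of products of linear observables with `ξ ∈ L^-`. For such `ξ` the vacuum factor
`exp(-ω(ξ, Jξ)/2)` is `1`, because `Jξ = -iξ`, and the generating function is the exponential of a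
linear form. The correlation function of a product is then the amplitude times the product of the
values at the averaged interior solution `P^+ φ + P^- τ` (`prodCorr_of_mem_Lminus`, `hatAvg_eq`).
Summing the Taylor series gives `K_τ(φ) F(P^+ φ + P^- τ) = F(φ) K_τ(φ)` as soon as the modes contain
`τ` and `φ`, so the limit over modes is eventually constant. Point evaluations are continuous and
coherent states span a dense subspace, so multiplication by `F` is the only continuous extension.

Two points need work. First, a decomposition into products of linear observables is not unique. The
correlation function depends only on the symmetric tensor, by symmetry of iterated derivatives, and
the tensor is determined by its polynomial function (`sum_symmetric_eq_zero`, `sum_prodCorr_eq`).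

Second, a decomposition must exist although `F` is only assumed entire on each line, with no joint
continuity. This is a Hartogs-type argument: Baire's theorem bounds `F` on one bidisc in a given
plane, a Remez-type inequality spreads the bound to all bidiscs with the same centre, and Cauchy
estimates make the Taylor coefficients polynomial on lines (`isLinePolynomial_lineCoeff`).
Interpolation turns this into polynomiality in finitely many variables
(`exists_sum_prod_of_homogeneous`). -/

/-- The `n`-th Taylor coefficient at `c` of `F` in the direction `v`. -/
noncomputable def lineCoeff {V : Type*} [AddCommGroup V] [Module ℂ V] (F : V → ℂ) (c : V) (n : ℕ)
    (v : V) : ℂ :=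
  (n.factorial : ℂ)⁻¹ * iteratedDeriv n (fun z : ℂ => F (c + z • v)) 0

section LineCoeff

variable {V : Type*} [AddCommGroup V] [Module ℂ V] {F : V → ℂ}

theorem hasSum_lineCoeff (hF : IsLineHolomorphic F) (c v : V) (w : ℂ) :
    HasSum (fun n => w ^ n * lineCoeff F c n v) (F (c + w • v)) := by
  have h := Complex.hasSum_taylorSeries_of_entire (hF c v) 0 w
  refine h.congr_fun fun n => ?_
  simp only [lineCoeff, sub_zero, smul_eq_mul]
  ring

theorem lineCoeff_smul (hF : IsLineHolomorphic F) (c v : V) (n : ℕ) (w : ℂ) :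
    lineCoeff F c n (w • v) = w ^ n * lineCoeff F c n v := by
  have h := iteratedDeriv_comp_const_mul (n := n) ((hF c v).contDiff (n := n)) w
  have h0 := congrFun h 0
  simp only [mul_zero] at h0
  have e : (fun z : ℂ => F (c + z • w • v)) = fun z : ℂ => F (c + (w * z) • v) := by
    funext z; rw [smul_smul, mul_comm]
  rw [lineCoeff, e, h0, lineCoeff]
  ring

theorem norm_lineCoeff_le (hF : IsLineHolomorphic F) {c v : V} {ρ M : ℝ} (hρ : 0 < ρ)
    (hM : ∀ u : ℂ, ‖u‖ ≤ ρ → ‖F (c + u • v)‖ ≤ M) (n : ℕ) :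
    ‖lineCoeff F c n v‖ ≤ M / ρ ^ n := by
  have h := Complex.norm_iteratedDeriv_le_of_forall_mem_sphere_norm_le n hρ
    (hF c v).diffContOnCl (C := M) fun z hz => hM z (by simpa using (mem_sphere_zero_iff_norm.mp hz).le)
  have hf : (0 : ℝ) < n.factorial := by positivity
  rw [lineCoeff, norm_mul, norm_inv, Complex.norm_natCast]
  calc _ ≤ (n.factorial : ℝ)⁻¹ * (n.factorial * M / ρ ^ n) := by gcongr
    _ = _ := by field_simp

/-- The tail of the series beyond degree `n` is dominated by a geometric series of ratio `1/2`. The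
bound depends on the coefficients only through `M` and `ρ`, which makes the convergence as `w → 0`
uniform in parameters. -/
theorem norm_taylor_quotient_sub_le {c : ℕ → ℂ} {w y : ℂ} {M ρ : ℝ} (hρ : 0 < ρ)
    (hc : ∀ k, ‖c k‖ ≤ M / ρ ^ k) (hw0 : w ≠ 0) (hw : ‖w‖ ≤ ρ / 2)
    (hy : HasSum (fun k => w ^ k * c k) y) (n : ℕ) :
    ‖(w ^ n)⁻¹ * (y - ∑ k ∈ Finset.range n, w ^ k * c k) - c n‖ ≤ 2 * M / ρ ^ (n + 1) * ‖w‖ := by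
  have hM : 0 ≤ M := by simpa using (norm_nonneg _).trans (hc 0)
  have ht := (hasSum_nat_add_iff' (n + 1)).mpr hy
  have hb : ∀ k, ‖w ^ (k + (n + 1)) * c (k + (n + 1))‖
      ≤ ‖w‖ ^ (n + 1) * (M / ρ ^ (n + 1)) * (1 / 2) ^ k := fun k => by
    rw [norm_mul, norm_pow]
    calc _ ≤ ‖w‖ ^ (k + (n + 1)) * (M / ρ ^ (k + (n + 1))) := by gcongr; exact hc _
      _ = ‖w‖ ^ (n + 1) * (M / ρ ^ (n + 1)) * (‖w‖ / ρ) ^ k := by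
        rw [div_pow]; field_simp; ring
      _ ≤ _ := by
        have : ‖w‖ / ρ ≤ 1 / 2 := by rw [div_le_div_iff₀ hρ two_pos]; linarith
        gcongr
  have hn := tsum_of_norm_bounded (hasSum_geometric_two.mul_left _) hb
  rw [ht.tsum_eq] at hn
  have e : (w ^ n)⁻¹ * (y - ∑ k ∈ Finset.range n, w ^ k * c k) - c n
      = (w ^ n)⁻¹ * (y - ∑ k ∈ Finset.range (n + 1), w ^ k * c k) := by
    rw [Finset.sum_range_succ]; field_simp; ring
  rw [e, norm_mul, norm_inv, norm_pow]
  have hwp : 0 < ‖w‖ := norm_pos_iff.mpr hw0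
  calc _ ≤ (‖w‖ ^ n)⁻¹ * (‖w‖ ^ (n + 1) * (M / ρ ^ (n + 1)) * 2) := by gcongr
    _ = _ := by field_simp; ring

/-- The radius `r / (1 + R)` keeps both coordinates `u` and `u z` within `r`, so Cauchy estimates
hold uniformly for directions `a + z b` with `‖z‖ ≤ R`. -/
theorem norm_le_on_line {c a b : V} {r M R : ℝ} (hr : 0 < r) (hR : 0 ≤ R)
    (hM : ∀ s t : ℂ, ‖s‖ ≤ r → ‖t‖ ≤ r → ‖F (c + s • a + t • b)‖ ≤ M) {z : ℂ} (hz : ‖z‖ ≤ R)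
    {u : ℂ} (hu : ‖u‖ ≤ r / (1 + R)) : ‖F (c + u • (a + z • b))‖ ≤ M := by
  have h1 : r / (1 + R) * (1 + R) = r := by field_simp
  have hr' : 0 < r / (1 + R) := by positivity
  rw [smul_add, smul_smul, ← add_assoc]
  refine hM _ _ (by nlinarith) ?_
  rw [norm_mul]
  have := mul_le_mul hu hz (norm_nonneg _) hr'.le
  linarith

/-- By induction on the degree: subtracting the lower Taylor terms and dividing by `w ^ n` gives
entire functions of `z`, which converge uniformly on discs as `w → 0`. A locally uniform limit of
holomorphic functions is holomorphic. -/
theorem differentiable_lineCoeff (hF : IsLineHolomorphic F) {c a b : V} {r M : ℝ} (hr : 0 < r)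
    (hM : ∀ s t : ℂ, ‖s‖ ≤ r → ‖t‖ ≤ r → ‖F (c + s • a + t • b)‖ ≤ M) (n : ℕ) :
    Differentiable ℂ fun z : ℂ => lineCoeff F c n (a + z • b) := by
  induction n using Nat.strong_induction_on with
  | _ n ih =>
  intro z₀
  set R : ℝ := ‖z₀‖ + 1 with hRdef
  have hR : 0 ≤ R := by positivity
  set ρ : ℝ := r / (1 + R) with hρdef
  have hρ : 0 < ρ := by positivity
  let w : ℕ → ℂ := fun N => ((ρ / 2 / (N + 1) : ℝ) : ℂ)
  have hwn : ∀ N, ‖w N‖ = ρ / 2 / (N + 1) := fun N => by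
    simp only [w]
    rw [Complex.norm_real, Real.norm_of_nonneg (by positivity)]
  have hw0 : ∀ N, w N ≠ 0 := fun N => by
    rw [← norm_pos_iff, hwn]; positivity
  have hw : ∀ N, ‖w N‖ ≤ ρ / 2 := fun N => by
    rw [hwn]
    exact div_le_self (by positivity) (by linarith [Nat.cast_nonneg (α := ℝ) N])
  have hwt : Filter.Tendsto (fun N => ‖w N‖) Filter.atTop (nhds 0) := by
    simp only [hwn]
    exact tendsto_const_nhds.div_atTop (tendsto_natCast_atTop_atTop.atTop_add tendsto_const_nhds)
  have hlim : TendstoUniformlyOn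
      (fun N (z : ℂ) => (w N ^ n)⁻¹ * (F (c + w N • (a + z • b))
        - ∑ k ∈ Finset.range n, w N ^ k * lineCoeff F c k (a + z • b)))
      (fun z : ℂ => lineCoeff F c n (a + z • b)) Filter.atTop (Metric.ball 0 R) := by
    rw [Metric.tendstoUniformlyOn_iff]
    intro ε hε
    have ht : Filter.Tendsto (fun N => 2 * M / ρ ^ (n + 1) * ‖w N‖) Filter.atTop (nhds 0) := by
      simpa using hwt.const_mul (2 * M / ρ ^ (n + 1))
    filter_upwards [ht.eventually_lt_const hε] with N hN z hz
    have hz' : ‖z‖ ≤ R := (mem_ball_zero_iff.mp hz).le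
    rw [dist_comm, dist_eq_norm]
    refine lt_of_le_of_lt (norm_taylor_quotient_sub_le hρ (fun k => ?_) (hw0 N) (hw N)
      (hasSum_lineCoeff hF _ _ _) n) hN
    exact norm_lineCoeff_le hF hρ (fun u hu => norm_le_on_line hr hR hM hz' hu) k
  have hd := hlim.tendstoLocallyUniformlyOn.differentiableOn
    (Filter.Eventually.of_forall fun N => ?_) Metric.isOpen_ball
  · exact hd.differentiableAt (Metric.isOpen_ball.mem_nhds (by simp [hRdef]))
  · refine (Differentiable.const_mul (Differentiable.sub ?_ ?_) _).differentiableOn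
    · have e : (fun z : ℂ => F (c + w N • (a + z • b)))
          = fun z => F (c + w N • a + z • w N • b) := by
        funext z
        rw [smul_add, smul_smul, smul_smul, mul_comm, add_assoc]
      rw [e]
      exact hF _ _
    · exact Differentiable.fun_sum fun k hk => (ih k (Finset.mem_range.mp hk)).const_mul _

/-- An entire function of polynomial growth is a polynomial. -/
theorem exists_polynomial_of_growth {h : ℂ → ℂ} (hh : Differentiable ℂ h) {n : ℕ} {C : ℝ}
    (hC : ∀ z : ℂ, 1 ≤ ‖z‖ → ‖h z‖ ≤ C * ‖z‖ ^ n) :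
    ∃ p : Polynomial ℂ, p.natDegree ≤ n ∧ ∀ z, h z = p.eval z := by
  have hzero : ∀ k, n < k → iteratedDeriv k h 0 = 0 := by
    intro k hk
    -- Cauchy's estimate on the circle of radius `R`; for `k > n` it tends to `0` as `R → ∞`.
    have hb : ∀ R : ℝ, 1 ≤ R → ‖iteratedDeriv k h 0‖ ≤ k.factorial * C / R ^ (k - n) := by
      intro R hR
      have h1 := Complex.norm_iteratedDeriv_le_of_forall_mem_sphere_norm_le k
        (by linarith : 0 < R) hh.diffContOnCl (c := 0) (C := C * R ^ n) fun z hz => by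
          have hz' : ‖z‖ = R := by simpa using hz
          rw [← hz']; exact hC z (by linarith)
      refine h1.trans (le_of_eq ?_)
      have : R ^ k = R ^ (k - n) * R ^ n := by rw [← pow_add]; congr 1; omega
      rw [this]; field_simp
    have ht : Filter.Tendsto (fun R : ℝ => k.factorial * C / R ^ (k - n)) Filter.atTop (nhds 0) :=
      tendsto_const_nhds.div_atTop (Filter.tendsto_pow_atTop (by omega))
    rw [← norm_le_zero_iff]
    exact ge_of_tendsto ht (Filter.eventually_atTop.mpr ⟨1, hb⟩)
  refine ⟨∑ k ∈ Finset.range (n + 1),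
    Polynomial.monomial k ((k.factorial : ℂ)⁻¹ * iteratedDeriv k h 0), ?_, fun z => ?_⟩
  · refine Polynomial.natDegree_sum_le_of_forall_le _ _ fun k hk => ?_
    exact (Polynomial.natDegree_monomial_le _).trans (by simpa [Nat.lt_succ_iff] using hk)
  · have hs := Complex.hasSum_taylorSeries_of_entire hh 0 z
    have hs' : HasSum (fun k : ℕ => (k.factorial : ℂ)⁻¹ • (z - 0) ^ k • iteratedDeriv k h 0)
        (∑ k ∈ Finset.range (n + 1), (k.factorial : ℂ)⁻¹ • (z - 0) ^ k • iteratedDeriv k h 0) :=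
      hasSum_sum_of_ne_finset_zero fun k hk => by
        rw [hzero k (by simpa using hk)]; simp
    rw [hs.unique hs', Polynomial.eval_finsetSum]
    refine Finset.sum_congr rfl fun k _ => ?_
    simp only [sub_zero, smul_eq_mul, Polynomial.eval_monomial]
    ring

/-- `f` is a polynomial of degree at most `n` on every complex line. -/
def IsLinePolynomial (n : ℕ) (f : V → ℂ) : Prop :=
  ∀ a b : V, ∃ p : Polynomial ℂ, p.natDegree ≤ n ∧ ∀ z : ℂ, f (a + z • b) = p.eval z

theorem exists_polynomial_lineCoeff_of_bounded (hF : IsLineHolomorphic F) {c a b : V} {r M : ℝ}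
    (hr : 0 < r) (hM : ∀ s t : ℂ, ‖s‖ ≤ r → ‖t‖ ≤ r → ‖F (c + s • a + t • b)‖ ≤ M) (n : ℕ) :
    ∃ p : Polynomial ℂ, p.natDegree ≤ n ∧ ∀ z : ℂ, lineCoeff F c n (a + z • b) = p.eval z := by
  refine exists_polynomial_of_growth (differentiable_lineCoeff hF hr hM n)
    (C := M / (r / (1 + 1)) ^ n) fun z hz => ?_
  have hz0 : z ≠ 0 := by rintro rfl; simp at hz; linarith
  -- Homogeneity turns large `z` into the growth factor `‖z‖ ^ n` times a coefficient in a direction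
  -- with the bounded parameter `z⁻¹`, the roles of `a` and `b` being exchanged.
  have e : a + z • b = z • (b + z⁻¹ • a) := by
    rw [smul_add, smul_smul, mul_inv_cancel₀ hz0, one_smul, add_comm]
  rw [e, lineCoeff_smul hF, norm_mul, norm_pow, mul_comm]
  gcongr
  refine norm_lineCoeff_le hF (by positivity) (fun u hu => ?_) n
  refine norm_le_on_line (R := 1) hr zero_le_one (fun s t hs ht => ?_) ?_ hu
  · rw [add_right_comm]; exact hM t s ht hs
  · rw [norm_inv]; exact inv_le_one_of_one_le₀ hz

/-- A line-holomorphic function is bounded on some bidisc in every complex plane. -/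
theorem exists_bounded_bidisc (hF : IsLineHolomorphic F) (x a b : V) :
    ∃ (t₀ : ℂ) (r M : ℝ), 0 < r ∧
      ∀ s t : ℂ, ‖s‖ ≤ r → ‖t‖ ≤ r → ‖F (x + t₀ • b + s • a + t • b)‖ ≤ M := by
  -- Baire category: these sets are closed by continuity in `t` and cover the plane by continuity in
  -- `s` on the compact disc. One of them has an interior point `t₀`, which need not be `0`.
  let E : ℕ → Set ℂ := fun M => {t | ∀ s : ℂ, ‖s‖ ≤ 1 → ‖F (x + t • b + s • a)‖ ≤ M}
  have hcl : ∀ M, IsClosed (E M) := fun M => by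
    have : E M = ⋂ (s : ℂ) (_ : ‖s‖ ≤ 1), {t | ‖F (x + t • b + s • a)‖ ≤ M} := by
      ext t; simp [E]
    rw [this]
    refine isClosed_iInter fun s => isClosed_iInter fun _ => isClosed_le ?_ continuous_const
    refine ((hF (x + s • a) b).continuous.congr fun t => ?_).norm
    rw [add_right_comm]
  have hun : ⋃ M, E M = Set.univ := by
    refine Set.eq_univ_of_forall fun t => Set.mem_iUnion.mpr ?_
    obtain ⟨C, hC⟩ := (isCompact_closedBall (0 : ℂ) 1).exists_bound_of_continuousOn
      (hF (x + t • b) a).continuous.continuousOn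
    obtain ⟨M, hM⟩ := exists_nat_ge C
    exact ⟨M, fun s hs => (hC s (by simpa using hs)).trans hM⟩
  obtain ⟨M, t₀, ht₀⟩ := nonempty_interior_of_iUnion_of_closed hcl hun
  obtain ⟨ε, hε, hball⟩ := Metric.isOpen_iff.mp isOpen_interior t₀ ht₀
  refine ⟨t₀, min 1 (ε / 2), M, by positivity, fun s t hs ht => ?_⟩
  have ht' : t₀ + t ∈ E M := interior_subset (hball (by
    rw [Metric.mem_ball, dist_eq_norm, add_sub_cancel_left]
    exact (ht.trans (min_le_right _ _)).trans_lt (by linarith)))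
  have := ht' s (hs.trans (min_le_left _ _))
  rwa [show x + t₀ • b + s • a + t • b = x + (t₀ + t) • b + s • a by rw [add_smul]; abel]

end LineCoeff

/-! ### A Remez-type inequality -/

section Remez

open MeasureTheory

/-- Greedy choice: take a point near the infimum, discard everything less than `δ` above it, and
repeat with what is left. -/
theorem exists_separated_points {δ : ℝ} (hδ : 0 < δ) (k : ℕ) (S : Set ℝ) (hS : S ⊆ Set.Icc 0 1)
    (hv : k * δ < volume.real S) :
    ∃ x : ℕ → ℝ, (∀ i ≤ k, x i ∈ S) ∧ ∀ i < k, x i + δ ≤ x (i + 1) := by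
  have hfin : ∀ T : Set ℝ, T ⊆ Set.Icc 0 1 → volume T ≠ ⊤ := fun T hT =>
    ((measure_mono hT).trans_lt (by simp)).ne
  induction k generalizing S with
  | zero =>
    have : S.Nonempty := by
      rw [Set.nonempty_iff_ne_empty]
      rintro rfl
      simp at hv
    obtain ⟨y, hy⟩ := this
    exact ⟨fun _ => y, fun _ _ => hy, fun _ hi => absurd hi (Nat.not_lt_zero _)⟩
  | succ k ih =>
    have hne : S.Nonempty := by
      rw [Set.nonempty_iff_ne_empty]
      rintro rfl
      rw [measureReal_empty] at hv
      exact absurd hv (not_lt.mpr (by positivity))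
    -- The point may exceed the infimum by less than the surplus of measure, so that more than `k *
    -- δ` remains after the cut at `y + δ`.
    obtain ⟨y, hyS, hy⟩ := exists_lt_of_csInf_lt hne
      (show sInf S < sInf S + (volume.real S - (k + 1 : ℕ) * δ) by linarith)
    have hsub : S ∩ Set.Ici (y + δ) ⊆ Set.Icc 0 1 := Set.inter_subset_left.trans hS
    have hbdd : BddBelow S := ⟨0, fun s hs => (hS hs).1⟩
    have hm : sInf S ≤ y := csInf_le hbdd hyS
    obtain ⟨x, hx, hxs⟩ := ih (S ∩ Set.Ici (y + δ)) hsub (by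
      have hcov : S ⊆ Set.Ico (sInf S) (y + δ) ∪ S ∩ Set.Ici (y + δ) := fun s hs => by
        rcases lt_or_ge s (y + δ) with h | h
        · exact Or.inl ⟨csInf_le hbdd hs, h⟩
        · exact Or.inr ⟨hs, h⟩
      have h1 : volume.real S ≤ volume.real (Set.Ico (sInf S) (y + δ))
          + volume.real (S ∩ Set.Ici (y + δ)) :=
        (measureReal_mono hcov (by
          refine (measure_union_lt_top ?_ (hfin _ hsub).lt_top).ne
          simp)).trans (measureReal_union_le _ _)
      rw [Real.volume_real_Ico_of_le (by linarith)] at h1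
      push_cast at hy
      linarith)
    refine ⟨fun i => Nat.casesOn i y x, fun i hi => ?_, fun i hi => ?_⟩
    · cases i with
      | zero => exact hyS
      | succ i => exact (hx i (by omega)).1
    · cases i with
      | zero => exact (hx 0 (Nat.zero_le _)).2
      | succ i => exact hxs i (by omega)

theorem prod_erase_abs_sub (n i : ℕ) (hi : i ≤ n) :
    ∏ j ∈ (Finset.range (n + 1)).erase i, |(i : ℝ) - j| = (i.factorial * (n - i).factorial : ℕ) := by
  have hs : (Finset.range (n + 1)).erase i = Finset.range i ∪ Finset.Ico (i + 1) (n + 1) := by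
    ext j
    simp only [Finset.mem_erase, Finset.mem_range, Finset.mem_union, Finset.mem_Ico]
    omega
  rw [hs, Finset.prod_union, Nat.cast_mul]
  · congr 1
    · rw [← Finset.prod_range_reflect, ← Finset.prod_range_add_one_eq_factorial, Nat.cast_prod]
      refine Finset.prod_congr rfl fun j hj => ?_
      have hj' := Finset.mem_range.mp hj
      have : ((i - 1 - j : ℕ) : ℝ) = i - 1 - j := by
        rw [Nat.cast_sub (by omega), Nat.cast_sub (by omega)]; simp
      rw [this]
      push_cast
      rw [abs_of_nonneg] <;> [ring; linarith [Nat.cast_nonneg (α := ℝ) j]]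
    · rw [Finset.prod_Ico_eq_prod_range, ← Finset.prod_range_add_one_eq_factorial, Nat.cast_prod]
      refine Finset.prod_congr (by congr 1; omega) fun j _ => ?_
      push_cast
      rw [abs_sub_comm, abs_of_nonneg] <;> [ring; linarith [Nat.cast_nonneg (α := ℝ) j]]
  · rw [Finset.disjoint_left]
    intro j hj hj'
    simp only [Finset.mem_range, Finset.mem_Ico] at hj hj'
    omega

theorem sum_inv_factorial_mul (n : ℕ) :
    ∑ i ∈ Finset.range (n + 1), (((i.factorial * (n - i).factorial : ℕ) : ℝ))⁻¹
      = 2 ^ n / n.factorial := by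
  have : ∀ i ∈ Finset.range (n + 1), (((i.factorial * (n - i).factorial : ℕ) : ℝ))⁻¹
      = (n.choose i : ℝ) / n.factorial := fun i hi => by
    have hi' : i ≤ n := Nat.lt_succ_iff.mp (Finset.mem_range.mp hi)
    rw [← Nat.choose_mul_factorial_mul_factorial hi']
    have : (n.choose i : ℝ) ≠ 0 := by exact_mod_cast (Nat.choose_pos hi').ne'
    push_cast
    field_simp
  rw [Finset.sum_congr rfl this, ← Finset.sum_div]
  congr 1
  exact_mod_cast Nat.sum_range_choose n

theorem mul_sub_le_of_separated {δ : ℝ} {n : ℕ} {x : ℕ → ℝ}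
    (hx : ∀ i < n, x i + δ ≤ x (i + 1)) {i j : ℕ} (hij : i ≤ j) (hj : j ≤ n) :
    δ * ((j : ℝ) - i) ≤ x j - x i := by
  induction j, hij using Nat.le_induction with
  | base => simp
  | succ j hij ih =>
    have h1 := ih (by omega)
    have h2 := hx j (by omega)
    push_cast
    linarith

/-- A **Remez-type inequality**: a polynomial that is bounded on a subset of `[0, 1]` of measure
greater than `1 / 2` is bounded exponentially in its degree. -/
theorem norm_eval_le_of_volume {p : Polynomial ℂ} {n : ℕ} (hp : p.natDegree ≤ n) {S : Set ℝ}
    (hS : S ⊆ Set.Icc 0 1) (hv : 1 / 2 < volume.real S) {M : ℝ}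
    (hM : ∀ x ∈ S, ‖p.eval (x : ℂ)‖ ≤ M) (z : ℂ) :
    ‖p.eval z‖ ≤ M * Real.exp 2 * (Real.exp 4 * (1 + ‖z‖)) ^ n := by
  -- With this `δ`, `n * δ < 1 / 2`, so `S` contains `n + 1` nodes that are `δ`-separated. Lagrange
  -- interpolation there has denominators at least `δ ^ n * i! * (n - i)!`, and the sum of the
  -- reciprocals leaves `(4 n + 2) ^ n / n! ≤ exp (4 n + 2)`.
  set δ : ℝ := 1 / (2 * n + 1) with hδdef
  have hδ : 0 < δ := by positivity
  obtain ⟨x, hxS, hx⟩ := exists_separated_points hδ n S hS (by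
    refine lt_of_le_of_lt ?_ hv
    rw [hδdef, mul_one_div, div_le_div_iff₀ (by positivity) two_pos]
    linarith)
  have hM0 : 0 ≤ M := (norm_nonneg _).trans (hM _ (hxS 0 (Nat.zero_le _)))
  have hsep : ∀ i ≤ n, ∀ j ≤ n, δ * |(i : ℝ) - j| ≤ |x i - x j| := by
    have key : ∀ i j, i ≤ j → j ≤ n → δ * |(i : ℝ) - j| ≤ |x i - x j| := fun i j hij hj => by
      have h := mul_sub_le_of_separated hx hij hj
      have h0 : (0 : ℝ) ≤ (j : ℝ) - i := sub_nonneg.mpr (by exact_mod_cast hij)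
      rw [abs_sub_comm, abs_of_nonneg h0, abs_sub_comm]
      exact h.trans (le_abs_self _)
    intro i hi j hj
    rcases le_total i j with hij | hij
    · exact key i j hij hj
    · rw [abs_sub_comm, abs_sub_comm (x i)]; exact key j i hij hi
  have hinj : Set.InjOn (fun i => (x i : ℂ)) (Finset.range (n + 1) : Set ℕ) := by
    intro i hi j hj hij
    simp only [Finset.coe_range, Set.mem_Iio] at hi hj
    have h := hsep i (by omega) j (by omega)
    rw [Complex.ofReal_inj.mp hij, sub_self, abs_zero] at h
    have : |(i : ℝ) - j| = 0 := le_antisymm (by nlinarith [abs_nonneg ((i : ℝ) - j)]) (abs_nonneg _)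
    exact_mod_cast sub_eq_zero.mp (abs_eq_zero.mp this)
  have hdeg : p.degree < (Finset.range (n + 1)).card := by
    rw [Finset.card_range]
    exact (Polynomial.degree_le_natDegree).trans_lt (by exact_mod_cast Nat.lt_succ_of_le hp)
  have hterm : ∀ i ∈ Finset.range (n + 1),
      ‖p.eval (x i : ℂ) * (Lagrange.basis (Finset.range (n + 1)) (fun i => (x i : ℂ)) i).eval z‖
      ≤ M * ((1 + ‖z‖) / δ) ^ n * (((i.factorial * (n - i).factorial : ℕ) : ℝ))⁻¹ := by
    intro i hi
    have hi' : i ≤ n := Nat.lt_succ_iff.mp (Finset.mem_range.mp hi)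
    rw [norm_mul, mul_assoc]
    refine mul_le_mul (hM _ (hxS i hi')) ?_ (norm_nonneg _) hM0
    rw [Lagrange.basis, Polynomial.eval_prod, norm_prod, ← prod_erase_abs_sub n i hi',
      ← Finset.prod_inv_distrib]
    have hcard : ((Finset.range (n + 1)).erase i).card = n := by
      rw [Finset.card_erase_of_mem hi, Finset.card_range, Nat.add_sub_cancel]
    have hpow : ((1 + ‖z‖) / δ) ^ n
        = ∏ _j ∈ (Finset.range (n + 1)).erase i, (1 + ‖z‖) / δ := by
      rw [Finset.prod_const, hcard]
    rw [hpow, ← Finset.prod_mul_distrib]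
    refine Finset.prod_le_prod (fun _ _ => norm_nonneg _) fun j hj => ?_
    have hj' : j ≤ n := Nat.lt_succ_iff.mp (Finset.mem_range.mp (Finset.mem_of_mem_erase hj))
    have hne : (i : ℝ) - j ≠ 0 := sub_ne_zero.mpr (by
      exact_mod_cast (Finset.ne_of_mem_erase hj).symm)
    have hpos : 0 < |(i : ℝ) - j| := abs_pos.mpr hne
    have hxj := hS (hxS j hj')
    simp only [Lagrange.basisDivisor, Polynomial.eval_mul, Polynomial.eval_C, Polynomial.eval_sub,
      Polynomial.eval_X, norm_mul, norm_inv]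
    rw [← Complex.ofReal_sub, Complex.norm_real, Real.norm_eq_abs, mul_comm, div_mul_eq_mul_div,
      mul_div_assoc]
    refine mul_le_mul ?_ ?_ (by positivity) (by positivity)
    · refine (norm_sub_le _ _).trans ?_
      rw [Complex.norm_real, Real.norm_of_nonneg hxj.1]
      linarith [hxj.2]
    · rw [div_eq_mul_inv, ← mul_inv, mul_comm]
      exact inv_anti₀ (by positivity) (hsep i hi' j hj')
  rw [Lagrange.eq_interpolate hinj hdeg, Lagrange.interpolate_apply, Polynomial.eval_finsetSum]
  simp only [Polynomial.eval_mul, Polynomial.eval_C]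
  calc _ ≤ _ := norm_sum_le_of_le _ hterm
    _ = M * (1 + ‖z‖) ^ n * ((4 * n + 2) ^ n / n.factorial) := by
      rw [← Finset.mul_sum, sum_inv_factorial_mul, hδdef, div_div_eq_mul_div, div_one, mul_pow,
        show (4 * n + 2 : ℝ) = (2 * n + 1) * 2 by ring, mul_pow]
      ring
    _ ≤ M * (1 + ‖z‖) ^ n * Real.exp (4 * n + 2) := by
      gcongr
      exact Real.pow_div_factorial_le_exp _ (by positivity) _
    _ = _ := by
      rw [Real.exp_add, mul_pow, ← Real.exp_nat_mul, mul_comm (4 : ℝ)]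
      ring

end Remez

/-! ### Hartogs-type propagation of bounds in a complex plane -/

section Hartogs

open MeasureTheory

variable {V : Type*} [AddCommGroup V] [Module ℂ V] {F : V → ℂ}

/-- On each line the Taylor series converges everywhere, so the coefficients decay faster than any
geometric rate, though not uniformly in `z`. Continuity of measure makes the bound uniform on more
than half of `[0, 1]`, and the Remez-type inequality extends it to all `z` at the cost of a factor
exponential in the degree. -/
theorem exists_norm_lineCoeff_le_geometric (hF : IsLineHolomorphic F) {c a b : V} {r M : ℝ}
    (hr : 0 < r) (hM : ∀ s t : ℂ, ‖s‖ ≤ r → ‖t‖ ≤ r → ‖F (c + s • a + t • b)‖ ≤ M) {ε : ℝ}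
    (hε : 0 < ε) :
    ∃ C : ℝ, ∀ (m : ℕ) (z : ℂ), ‖lineCoeff F c m (a + z • b)‖ ≤ C * (ε * (1 + ‖z‖)) ^ m := by
  choose p hpdeg hp using exists_polynomial_lineCoeff_of_bounded hF hr hM
  -- Chosen to absorb the factor `exp 4` per degree of the Remez-type inequality and leave `ε`.
  set R : ℝ := Real.exp 4 / ε with hR
  have hR0 : 0 < R := by positivity
  let S : ℕ → Set ℝ := fun N => {x | x ∈ Set.Icc (0 : ℝ) 1 ∧ ∀ m, ‖(p m).eval (x : ℂ)‖ ≤ N / R ^ m}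
  have hmono : Monotone S := fun N N' h x hx =>
    ⟨hx.1, fun m => (hx.2 m).trans (by gcongr)⟩
  have hun : ⋃ N, S N = Set.Icc (0 : ℝ) 1 := by
    refine Set.Subset.antisymm (Set.iUnion_subset fun N x hx => hx.1) fun x hx => ?_
    obtain ⟨B, hB⟩ := (hasSum_lineCoeff hF c (a + (x : ℂ) • b) R).summable.tendsto_atTop_zero.norm
      |>.bddAbove_range
    obtain ⟨N, hN⟩ := exists_nat_ge B
    refine Set.mem_iUnion.mpr ⟨N, hx, fun m => ?_⟩
    have h := hB ⟨m, rfl⟩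
    simp only [norm_mul, norm_pow, Complex.norm_real, Real.norm_of_nonneg hR0.le] at h
    rw [le_div_iff₀ (by positivity), ← hp m, mul_comm]
    exact h.trans hN
  have hlim := tendsto_measure_iUnion_atTop (μ := volume) hmono
  rw [hun, Real.volume_Icc, sub_zero, ENNReal.ofReal_one] at hlim
  obtain ⟨N, hN⟩ := (hlim.eventually_const_lt
    (show ENNReal.ofReal (1 / 2) < 1 by rw [ENNReal.ofReal_lt_one]; norm_num)).exists
  have hv : 1 / 2 < volume.real (S N) :=
    (ENNReal.ofReal_lt_iff_lt_toReal (by norm_num)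
      ((measure_mono fun x hx => hx.1 : volume (S N) ≤ volume (Set.Icc (0 : ℝ) 1)).trans_lt
        (by simp)).ne).mp hN
  refine ⟨N * Real.exp 2, fun m z => ?_⟩
  rw [hp m]
  refine (norm_eval_le_of_volume (hpdeg m) (fun x hx => hx.1) hv (fun x hx => hx.2 m) z).trans
    (le_of_eq ?_)
  rw [hR, div_pow, mul_pow, mul_pow]
  field_simp

theorem exists_bounded_of_bounded_bidisc (hF : IsLineHolomorphic F) {c a b : V} {r M : ℝ}
    (hr : 0 < r) (hM : ∀ s t : ℂ, ‖s‖ ≤ r → ‖t‖ ≤ r → ‖F (c + s • a + t • b)‖ ≤ M) {ρ : ℝ}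
    (hρ : 0 < ρ) :
    ∃ C : ℝ, ∀ s t : ℂ, ‖s‖ ≤ ρ → ‖t‖ ≤ ρ → ‖F (c + s • a + t • b)‖ ≤ C := by
  -- Along the direction `a + (t / s) b` the terms are at most `C * ((‖s‖ + ‖t‖) / (4 ρ)) ^ m ≤ C *
  -- (1 / 2) ^ m`. The excluded value `s = 0` follows by continuity in `s`.
  obtain ⟨C, hC⟩ := exists_norm_lineCoeff_le_geometric hF hr hM
    (show (0 : ℝ) < 1 / (4 * ρ) by positivity)
  have hC0 : 0 ≤ C := by simpa using (norm_nonneg _).trans (hC 0 0)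
  have hne : ∀ s t : ℂ, s ≠ 0 → ‖s‖ ≤ ρ → ‖t‖ ≤ ρ → ‖F (c + s • a + t • b)‖ ≤ C * 2 := by
    intro s t hs0 hs ht
    have e : c + s • a + t • b = c + s • (a + (t / s) • b) := by
      rw [smul_add, smul_smul, mul_div_cancel₀ _ hs0, add_assoc]
    rw [e, ← (hasSum_lineCoeff hF c _ s).tsum_eq]
    refine tsum_of_norm_bounded (hasSum_geometric_two.mul_left C) fun m => ?_
    have hs' : 0 < ‖s‖ := norm_pos_iff.mpr hs0
    rw [norm_mul, norm_pow]
    calc _ ≤ ‖s‖ ^ m * (C * (1 / (4 * ρ) * (1 + ‖t / s‖)) ^ m) := by gcongr; exact hC _ _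
      _ = C * ((‖s‖ + ‖t‖) / (4 * ρ)) ^ m := by
        rw [mul_left_comm, ← mul_pow, norm_div]
        congr 2
        field_simp
      _ ≤ _ := by
        have : (‖s‖ + ‖t‖) / (4 * ρ) ≤ 1 / 2 := by
          rw [div_le_div_iff₀ (by positivity) two_pos]
          linarith
        gcongr
  refine ⟨C * 2, fun s t hs ht => ?_⟩
  by_cases hs0 : s = 0
  · have hcont : Continuous fun z : ℂ => ‖F (c + z • a + t • b)‖ := by
      refine ((hF (c + t • b) a).continuous.congr fun z => ?_).norm
      rw [add_right_comm]
    have hlim := (hcont.tendsto s).mono_left (nhdsWithin_le_nhds (s := {0}ᶜ))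
    rw [hs0] at hlim ⊢
    refine le_of_tendsto hlim ?_
    have h1 : ∀ᶠ z in nhdsWithin (0 : ℂ) {0}ᶜ, ‖z‖ < ρ :=
      (continuous_norm.tendsto' (0 : ℂ) 0 norm_zero |>.mono_left nhdsWithin_le_nhds).eventually_lt_const hρ
    filter_upwards [h1, self_mem_nhdsWithin] with z hz hz0
    exact hne z t hz0 hz.le ht
  · exact hne s t hs0 hs ht

/-- The Taylor coefficients of a line-holomorphic function are polynomials on every line. -/
theorem isLinePolynomial_lineCoeff (hF : IsLineHolomorphic F) (x : V) (n : ℕ) :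
    IsLinePolynomial n (lineCoeff F x n) := by
  intro a b
  obtain ⟨t₀, r, M, hr, hM⟩ := exists_bounded_bidisc hF x a b
  -- The radius `1 + ‖t₀‖` makes the bidisc centred at `x + t₀ b` contain the unit bidisc centred at
  -- `x`.
  obtain ⟨C, hC⟩ := exists_bounded_of_bounded_bidisc hF hr hM
    (show (0 : ℝ) < 1 + ‖t₀‖ by positivity)
  refine exists_polynomial_lineCoeff_of_bounded hF one_pos (M := C) (fun s t hs ht => ?_) n
  have := hC s (t - t₀) (by linarith [norm_nonneg t₀])
    ((norm_sub_le _ _).trans (by linarith))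
  rwa [show x + t₀ • b + s • a + (t - t₀) • b = x + s • a + t • b by rw [sub_smul]; abel] at this

end Hartogs

/-! ### Polynomials in finitely many variables -/

section Polynomials

variable {d n : ℕ}

theorem List.perm_ofFn_of_sum_single_eq {α β : Fin n → Fin d}
    (h : ∑ k, Finsupp.single (α k) 1 = ∑ k, Finsupp.single (β k) 1) :
    (List.ofFn α).Perm (List.ofFn β) := by
  have key : ∀ γ : Fin n → Fin d, ((List.ofFn γ : List (Fin d)) : Multiset (Fin d))
      = Finsupp.toMultiset (∑ k, Finsupp.single (γ k) 1) := fun γ => by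
    rw [map_sum]
    simp only [Finsupp.toMultiset_single, one_smul]
    have h1 : ∑ k, ({γ k} : Multiset (Fin d))
        = ((Finset.univ.val.map γ).map fun a => ({a} : Multiset (Fin d))).sum := by
      rw [Multiset.map_map]; rfl
    rw [h1, Multiset.sum_map_singleton, Fin.univ_val_map]
  rw [← Multiset.coe_eq_coe, key, key, h]

/-- Index tuples with the same multiplicities become equal after sorting. -/
theorem exists_perm_comp_eq {α β : Fin n → Fin d}
    (h : ∑ k, Finsupp.single (α k) 1 = ∑ k, Finsupp.single (β k) 1) :
    ∃ σ τ : Equiv.Perm (Fin n), α ∘ σ = β ∘ τ := by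
  refine ⟨Tuple.sort α, Tuple.sort β, List.ofFn_injective ?_⟩
  exact ((((Tuple.sort α).ofFn_comp_perm α).trans (List.perm_ofFn_of_sum_single_eq h)).trans
    ((Tuple.sort β).ofFn_comp_perm β).symm).eq_of_pairwise'
    (Tuple.monotone_sort α).sortedLE_ofFn.pairwise
    (Tuple.monotone_sort β).sortedLE_ofFn.pairwise

theorem MultilinearMap.apply_eq_sum_pi (M : MultilinearMap ℂ (fun _ : Fin n => Fin d → ℂ) ℂ)
    (x : Fin n → Fin d → ℂ) :
    M x = ∑ α : Fin n → Fin d, (∏ k, x k (α k)) * M fun k => Pi.single (α k) 1 := by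
  have hx : x = fun k => ∑ a, x k a • (Pi.single a 1 : Fin d → ℂ) := by
    funext k
    exact pi_eq_sum_univ' (x k)
  conv_lhs => rw [hx]
  rw [M.map_sum]
  refine Finset.sum_congr rfl fun α _ => ?_
  rw [M.map_smul_univ, smul_eq_mul]

theorem prod_linearForm_eq_sum (x : Fin n → Fin d → ℂ) :
    ∏ k, ∑ a, MvPolynomial.C (x k a) * MvPolynomial.X a
      = ∑ α : Fin n → Fin d,
        MvPolynomial.monomial (∑ k, Finsupp.single (α k) 1) (∏ k, x k (α k)) := by
  rw [Finset.prod_univ_sum, Fintype.piFinset_univ]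
  refine Finset.sum_congr rfl fun α _ => ?_
  rw [MvPolynomial.monomial_sum_index, Finset.prod_mul_distrib, map_prod]
  rfl

/-- A symmetric multilinear map depends on the symmetric tensor only, which is determined by the
corresponding homogeneous polynomial. -/
theorem sum_symmetric_eq_zero (M : MultilinearMap ℂ (fun _ : Fin n => Fin d → ℂ) ℂ)
    (hM : ∀ (x : Fin n → Fin d → ℂ) (σ : Equiv.Perm (Fin n)), M (x ∘ σ) = M x)
    {ι : Type*} (s : Finset ι) (c : ι → ℂ) (x : ι → Fin n → Fin d → ℂ)
    (h : ∀ y : Fin d → ℂ, ∑ j ∈ s, c j * ∏ k, ∑ a, x j k a * y a = 0) :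
    ∑ j ∈ s, c j * M (x j) = 0 := by
  classical
  let e : (Fin n → Fin d) → (Fin n → Fin d → ℂ) := fun α k => Pi.single (α k) 1
  have hwd : ∀ α β : Fin n → Fin d,
      ∑ k, Finsupp.single (α k) 1 = ∑ k, Finsupp.single (β k) 1 → M (e α) = M (e β) := by
    intro α β hαβ
    obtain ⟨σ, τ, hστ⟩ := exists_perm_comp_eq hαβ
    rw [← hM (e α) σ, ← hM (e β) τ]
    exact congrArg (fun γ => M (e γ)) hστ
  -- By symmetry `M` on basis vectors depends only on the exponent of the monomial, so it induces a
  -- linear functional on polynomials. The value `0` on exponents of degree other than `n` is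
  -- irrelevant.
  let f : (Fin d →₀ ℕ) → ℂ := fun m =>
    if h : ∃ α : Fin n → Fin d, ∑ k, Finsupp.single (α k) 1 = m then M (e h.choose) else 0
  have hf : ∀ α : Fin n → Fin d, f (∑ k, Finsupp.single (α k) 1) = M (e α) := fun α => by
    have hex : ∃ β : Fin n → Fin d, ∑ k, Finsupp.single (β k) 1 = ∑ k, Finsupp.single (α k) 1 :=
      ⟨α, rfl⟩
    simp only [f, dif_pos hex]
    exact hwd _ _ hex.choose_spec
  let Λ : MvPolynomial (Fin d) ℂ →ₗ[ℂ] ℂ := (MvPolynomial.basisMonomials (Fin d) ℂ).constr ℂ f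
  have hΛ : ∀ m a, Λ (MvPolynomial.monomial m a) = a * f m := fun m a => by
    have : MvPolynomial.monomial m a = a • MvPolynomial.basisMonomials (Fin d) ℂ m := by
      rw [MvPolynomial.coe_basisMonomials, MvPolynomial.smul_monomial, smul_eq_mul, mul_one]
    rw [this, map_smul, Module.Basis.constr_basis, smul_eq_mul]
  have hprod : ∀ j, Λ (∏ k, ∑ a, MvPolynomial.C (x j k a) * MvPolynomial.X a) = M (x j) :=
    fun j => by
      rw [prod_linearForm_eq_sum, map_sum, M.apply_eq_sum_pi]
      refine Finset.sum_congr rfl fun α _ => ?_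
      rw [hΛ, hf]
  have hzero : ∑ j ∈ s, c j • ∏ k, ∑ a, MvPolynomial.C (x j k a) * MvPolynomial.X a
      = (0 : MvPolynomial (Fin d) ℂ) := by
    refine MvPolynomial.funext fun y => ?_
    simpa [MvPolynomial.smul_eval, map_prod, map_sum] using h y
  have := congrArg Λ hzero
  rw [map_sum, map_zero] at this
  simpa only [map_smul, hprod, smul_eq_mul] using this

theorem exists_mvPolynomial_of_isLinePolynomial {f : (Fin d → ℂ) → ℂ} (hf : IsLinePolynomial n f) :
    ∃ q : MvPolynomial (Fin d) ℂ, ∀ x, f x = MvPolynomial.eval x q := by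
  induction d with
  | zero => exact ⟨MvPolynomial.C (f 0), fun x => by rw [Subsingleton.elim x 0]; simp⟩
  | succ d ih =>
    have hsl : ∀ i : ℕ, IsLinePolynomial n fun y : Fin d → ℂ => f (Fin.cons (i : ℂ) y) := by
      intro i a b
      obtain ⟨p, hp, h⟩ := hf (Fin.cons (i : ℂ) a) (Fin.cons 0 b)
      refine ⟨p, hp, fun z => ?_⟩
      rw [← h z]
      refine congrArg f (funext fun k => Fin.cases ?_ (fun k => ?_) k) <;> simp
    choose q hq using fun i => ih (hsl i)
    -- Lagrange interpolation in the first coordinate at the nodes `0, …, n`; the slices are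
    -- polynomials by induction.
    let v : ℕ → ℂ := fun i => i
    refine ⟨∑ i ∈ Finset.range (n + 1), MvPolynomial.rename Fin.succ (q i) *
      Polynomial.aeval (MvPolynomial.X 0) (Lagrange.basis (Finset.range (n + 1)) v i),
      fun x => ?_⟩
    obtain ⟨p, hp, h⟩ := hf (Fin.cons 0 (Fin.tail x)) (Fin.cons 1 0)
    have hcons : ∀ z : ℂ, f (Fin.cons z (Fin.tail x)) = p.eval z := fun z => by
      rw [← h z]
      refine congrArg f (funext fun k => Fin.cases ?_ (fun k => ?_) k) <;> simp
    have hdeg : p.degree < (Finset.range (n + 1)).card := by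
      rw [Finset.card_range]
      exact (Polynomial.degree_le_natDegree).trans_lt (by exact_mod_cast Nat.lt_succ_of_le hp)
    have hL := Lagrange.eq_interpolate (v := v) (Nat.cast_injective.injOn) hdeg
    rw [← Fin.cons_self_tail x, hcons, hL, Lagrange.interpolate_apply, Polynomial.eval_finsetSum,
      map_sum]
    refine Finset.sum_congr rfl fun i _ => ?_
    rw [map_mul, MvPolynomial.eval_rename, Polynomial.eval_mul, Polynomial.eval_C, ← hcons]
    congr 1
    · rw [show Fin.cons (x 0) (Fin.tail x) ∘ Fin.succ = Fin.tail x from rfl]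
      exact hq i _
    · rw [← MvPolynomial.aeval_eq_eval, ← Polynomial.aeval_algHom_apply, MvPolynomial.aeval_X,
        Fin.cons_zero, Polynomial.coe_aeval_eq_eval]

theorem exists_prod_of_degree {m : Fin d →₀ ℕ} (hm : m.degree = n) :
    ∃ α : Fin n → Fin d, ∀ y : Fin d → ℂ, ∏ k, y (α k) = m.prod fun i e => y i ^ e := by
  have hlen : m.toMultiset.toList.length = n := by
    rw [Multiset.length_toList, Finsupp.card_toMultiset]; exact hm
  subst hlen
  refine ⟨m.toMultiset.toList.get, fun y => ?_⟩
  have h1 : (m.prod fun i e => y i ^ e) = (m.toMultiset.map y).prod := by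
    rw [Finsupp.toMultiset_map, Finsupp.prod_toMultiset, Finsupp.prod_mapDomain_index] <;>
      simp [pow_add]
  rw [h1, ← Multiset.coe_toList m.toMultiset, Multiset.map_coe, Multiset.prod_coe,
    Multiset.coe_toList, ← List.prod_ofFn]
  congr 1
  exact List.ofFn_getElem_eq_map _ _

/-- A homogeneous function that is a polynomial on every line is a linear combination of products of
linear forms. -/
theorem exists_sum_prod_of_homogeneous {f : (Fin d → ℂ) → ℂ} (hf : IsLinePolynomial n f)
    (hom : ∀ (w : ℂ) x, f (w • x) = w ^ n * f x) :
    ∃ (N : ℕ) (c : Fin N → ℂ) (α : Fin N → Fin n → Fin d),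
      ∀ x, f x = ∑ j, c j * ∏ k, x (α j k) := by
  obtain ⟨q, hq⟩ := exists_mvPolynomial_of_isLinePolynomial hf
  -- Both sides of `q (w x) = w ^ n f x` are polynomials in `w`; the coefficients of `w ^ n` are
  -- compared.
  have hq' : ∀ x, f x = MvPolynomial.eval x (MvPolynomial.homogeneousComponent n q) := by
    intro x
    set N := max n q.totalDegree
    have hsum : ∀ w : ℂ, ∑ k ∈ Finset.range (N + 1),
        w ^ k * MvPolynomial.eval x (MvPolynomial.homogeneousComponent k q) = w ^ n * f x := by
      intro w
      have hN : q = ∑ k ∈ Finset.range (N + 1), MvPolynomial.homogeneousComponent k q := by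
        conv_lhs => rw [← MvPolynomial.sum_homogeneousComponent q]
        refine Finset.sum_subset (Finset.range_mono (by omega)) fun k _ hk => ?_
        exact MvPolynomial.homogeneousComponent_eq_zero _ _ (by simpa using hk)
      rw [← hom w x, hq, hN, map_sum]
      refine Finset.sum_congr rfl fun k hk => ?_
      rw [← hN]
      have hh := MvPolynomial.homogeneousComponent_isHomogeneous k q
      rw [MvPolynomial.eval_eq', MvPolynomial.eval_eq', Finset.mul_sum]
      refine Finset.sum_congr rfl fun m hm => ?_
      have hdeg : ∑ i, m i = k := by
        rw [← hh (MvPolynomial.mem_support_iff.mp hm), Finsupp.weight_apply,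
          Finsupp.sum_fintype] <;> simp
      simp only [Pi.smul_apply, smul_eq_mul, mul_pow, Finset.prod_mul_distrib,
        Finset.prod_pow_eq_pow_sum, hdeg]
      ring
    have hpoly : ∑ k ∈ Finset.range (N + 1), Polynomial.monomial k
        (MvPolynomial.eval x (MvPolynomial.homogeneousComponent k q))
        = Polynomial.monomial n (f x) := by
      refine Polynomial.funext fun w => ?_
      rw [Polynomial.eval_finsetSum, Polynomial.eval_monomial, mul_comm, ← hsum w]
      refine Finset.sum_congr rfl fun k _ => ?_
      rw [Polynomial.eval_monomial, mul_comm]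
    have := congrArg (fun p => Polynomial.coeff p n) hpoly
    simp only [Polynomial.finsetSum_coeff, Polynomial.coeff_monomial, if_true,
      Finset.sum_ite_eq'] at this
    rw [if_pos (Finset.mem_range.mpr (by omega))] at this
    exact this.symm
  set p := MvPolynomial.homogeneousComponent n q
  have hp : p.IsHomogeneous n := MvPolynomial.homogeneousComponent_isHomogeneous n q
  have hdeg : ∀ m : p.support, m.1.degree = n := fun m => by
    rw [← hp (MvPolynomial.mem_support_iff.mp m.2), Finsupp.weight_apply, Finsupp.degree_apply]
    simp [Finsupp.sum]
  choose α hα using fun m : p.support => exists_prod_of_degree (hdeg m)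
  let e := p.support.equivFin
  refine ⟨p.support.card, fun j => p.coeff (e.symm j).1, fun j => α (e.symm j), fun x => ?_⟩
  rw [hq', MvPolynomial.eval_eq, ← Finset.sum_coe_sort, ← e.symm.sum_comp]
  refine Finset.sum_congr rfl fun j _ => ?_
  rw [hα]
  rfl

end Polynomials

/-! ### Complexification and the polarizations -/

theorem toCx_add {L : Type*} [AddCommGroup L] [Module ℝ L] (x y : L) :
    toCx (x + y) = toCx x + toCx y :=
  TensorProduct.tmul_add _ _ _

theorem toCx_smul {L : Type*} [AddCommGroup L] [Module ℝ L] (r : ℝ) (x : L) :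
    toCx (r • x) = (r : ℂ) • toCx x := by
  simp [toCx, TensorProduct.smul_tmul', TensorProduct.tmul_smul]

theorem toCx_sub {L : Type*} [AddCommGroup L] [Module ℝ L] (x y : L) :
    toCx (x - y) = toCx x - toCx y :=
  TensorProduct.tmul_sub _ _ _

theorem Cx.exists_re_im_of_mem {L : Type*} [AddCommGroup L] [Module ℝ L] {V : Submodule ℝ L}
    {x : Cx L} (hx : x ∈ V.baseChange ℂ) :
    ∃ a ∈ V, ∃ b ∈ V, x = toCx a + Complex.I • toCx b := by
  rw [Submodule.baseChange_eq_span] at hx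
  induction hx using Submodule.span_induction with
  | mem x hx =>
    obtain ⟨a, ha, rfl⟩ := hx
    exact ⟨a, ha, 0, V.zero_mem, by simp [toCx]⟩
  | zero => exact ⟨0, V.zero_mem, 0, V.zero_mem, by simp [toCx]⟩
  | add x y _ _ hx hy =>
    obtain ⟨a, ha, b, hb, rfl⟩ := hx
    obtain ⟨c, hc, d, hd, rfl⟩ := hy
    refine ⟨a + c, V.add_mem ha hc, b + d, V.add_mem hb hd, ?_⟩
    rw [toCx_add, toCx_add, smul_add]
    abel
  | smul z x _ hx =>
    obtain ⟨a, ha, b, hb, rfl⟩ := hx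
    refine ⟨z.re • a - z.im • b, V.sub_mem (V.smul_mem _ ha) (V.smul_mem _ hb),
      z.im • a + z.re • b, V.add_mem (V.smul_mem _ ha) (V.smul_mem _ hb), ?_⟩
    simp only [toCx_add, toCx_sub, toCx_smul]
    conv_lhs => rw [← Complex.re_add_im z]
    match_scalars <;> ring_nf
    rw [Complex.I_sq]; ring

namespace KahlerPhaseSpace

variable {L : Type*} [AddCommGroup L] [Module ℝ L] (S : KahlerPhaseSpace L)

theorem JC_toCx (x : L) : S.JC (toCx x) = toCx (S.J x) := by
  simp [JC, toCx]

theorem ωC_toCx (x y : L) : S.ωC (toCx x) (toCx y) = S.ω x y := by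
  simp [ωC, toCx, LinearMap.BilinForm.baseChange_tmul]

theorem ωC_JC_JC (x y : Cx L) : S.ωC (S.JC x) (S.JC y) = S.ωC x y := by
  obtain ⟨a, b, rfl⟩ := Cx.exists_re_im x
  obtain ⟨c, d, rfl⟩ := Cx.exists_re_im y
  simp only [map_add, map_smul, LinearMap.add_apply, LinearMap.smul_apply, JC_toCx, ωC_toCx,
    S.compat]

theorem Pplus_add_Pminus (x : Cx L) : S.Pplus x + S.Pminus x = x := by
  simp only [Pplus, Pminus]; module

theorem JC_Pplus (x : Cx L) : S.JC (S.Pplus x) = Complex.I • S.Pplus x := by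
  simp only [Pplus, map_smul, map_sub, JC_JC]
  match_scalars <;> ring_nf
  rw [Complex.I_sq]; ring

theorem JC_Pminus (x : Cx L) : S.JC (S.Pminus x) = -Complex.I • S.Pminus x := by
  simp only [Pminus, map_smul, map_add, JC_JC]
  match_scalars <;> ring_nf
  rw [Complex.I_sq]; ring

theorem Pminus_mem_Lminus (x : Cx L) : S.Pminus x ∈ S.Lminus :=
  S.mem_Lminus.mpr (S.JC_Pminus x)

/-- `J` preserves `ω`, yet acts on the pair by the factor `(-i)^2 = -1`. -/
theorem ωC_eq_zero_of_mem_Lminus {x y : Cx L} (hx : x ∈ S.Lminus) (hy : y ∈ S.Lminus) :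
    S.ωC x y = 0 := by
  have h := S.ωC_JC_JC x y
  rw [S.mem_Lminus.mp hx, S.mem_Lminus.mp hy, map_smul, LinearMap.map_smul, LinearMap.smul_apply,
    smul_smul, neg_mul_neg, Complex.I_mul_I, smul_eq_mul] at h
  linear_combination (-1 / 2 : ℂ) * h

theorem ωC_Pplus_Pplus (x y : Cx L) : S.ωC (S.Pplus x) (S.Pplus y) = 0 := by
  have h := S.ωC_JC_JC (S.Pplus x) (S.Pplus y)
  rw [JC_Pplus, JC_Pplus, map_smul, LinearMap.map_smul, LinearMap.smul_apply,
    smul_smul, Complex.I_mul_I, smul_eq_mul] at h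
  linear_combination (-1 / 2 : ℂ) * h

/-- Both eigenspaces are isotropic, so either side equals `2 ω(P^- x, P^+ y)`. -/
theorem linObs_Pminus_left (x y : Cx L) : S.linObs (S.Pminus x) y = S.linObs x (S.Pplus y) := by
  have h1 : S.ωC (S.Pminus x) (S.Pminus y) = 0 :=
    S.ωC_eq_zero_of_mem_Lminus (S.Pminus_mem_Lminus x) (S.Pminus_mem_Lminus y)
  rw [linObs, linObs, ← S.Pplus_add_Pminus y]
  conv_rhs => rw [S.Pplus_add_Pminus y, ← S.Pplus_add_Pminus x, map_add, LinearMap.add_apply,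
    ωC_Pplus_Pplus]
  rw [map_add, h1]
  ring

/-! ### The amplitude and the correlation functions of Weyl observables -/

/-- The value of the boundary data `ζ` at which slice observables are evaluated. -/
noncomputable def hatAvg (ζ : L × L) : Cx L := (1 / 2 : ℂ) • ((S.hat ζ).1 + (S.hat ζ).2)

/-- The label `τ` enters only through `L^-`, which is why an observable invariant under `L^-` takes
a value depending on `φ` alone. -/
theorem hatAvg_eq (τ φ : L) : S.hatAvg (τ, φ) = S.Pplus (toCx φ) + S.Pminus (toCx τ) := by
  simp only [hatAvg, hat, toCx2, partR, partI, Prod.fst_sub, Prod.snd_sub, Prod.smul_fst,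
    Prod.smul_snd, toCx_smul, toCx_add, toCx_sub, map_sub, Pplus, Pminus, JC_toCx]
  push_cast
  module

theorem amplitude_eq (τ φ : L) : S.amplitude (τ, φ) = S.coh τ φ := by
  rw [coh_apply, amplitude, ← Complex.exp_add]
  congr 1
  apply Complex.ext
  · simp [herm, g, double, partR, partI, S.J_sq, S.alt, S.skew (S.J _) _, S.ω_J_comm φ τ]
    ring
  · simp [herm, g, double, partR, partI, S.J_sq, S.alt, S.skew φ τ]
    ring

theorem weylCorr_eq (ζ : L × L) (ξ : Cx L) :
    S.weylCorr ζ ξ = S.amplitude ζ *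
      Complex.exp (Complex.I * S.linObs ξ (S.hatAvg ζ) - 1 / 2 * S.ωC ξ (S.JC ξ)) := by
  rw [weylCorr, mul_assoc, onSlice, weylObs, ← Complex.exp_add, ← hatAvg]
  congr 3
  -- The average of the vacuum solution uses `P^- - P^+ = i J`; the vacuum factor thus becomes a
  -- Gaussian in `ξ`.
  have : (1 / 2 : ℂ) • ((S.vacuumSolution ξ).1 + (S.vacuumSolution ξ).2)
      = (Complex.I / 2) • S.JC ξ := by
    simp only [vacuumSolution, Pplus, Pminus]; module
  rw [onSlice, this, linObs, linObs, map_smul, smul_eq_mul]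
  linear_combination (1 / 2 : ℂ) * S.ωC ξ (S.JC ξ) * Complex.I_sq

theorem linObs_sum_left {ι : Type*} (s : Finset ι) (c : ι → ℂ) (e : ι → Cx L) (φ : Cx L) :
    S.linObs (∑ a ∈ s, c a • e a) φ = ∑ a ∈ s, c a * S.linObs (e a) φ := by
  simp only [linObs, map_sum, map_smul, LinearMap.sum_apply, LinearMap.smul_apply, smul_eq_mul,
    Finset.mul_sum]
  exact Finset.sum_congr rfl fun _ _ => by ring

theorem contDiff_weylCorr (ζ : L × L) {d : ℕ} (e : Fin d → Cx L) (n : WithTop ℕ∞) :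
    ContDiff ℂ n fun u : Fin d → ℂ => S.weylCorr ζ (∑ a, u a • e a) := by
  have h : (fun u : Fin d → ℂ => S.weylCorr ζ (∑ a, u a • e a)) = fun u =>
      S.amplitude ζ * Complex.exp (Complex.I * ∑ a, u a * S.linObs (e a) (S.hatAvg ζ)
        - 1 / 2 * ∑ a, u a * ∑ b, u b * S.ωC (e a) (S.JC (e b))) := by
    funext u
    rw [weylCorr_eq, linObs_sum_left]
    simp only [map_sum, map_smul, LinearMap.sum_apply, LinearMap.smul_apply, smul_eq_mul,
      Finset.mul_sum]
    rw [Finset.sum_comm]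
    simp only [mul_left_comm]
  rw [h]
  fun_prop

/-- By the chain rule the real mixed derivative is a complex derivative in the coordinates. This
exhibits the correlation function as a symmetric complex multilinear map of the coordinate vectors.
-/
theorem prodCorr_sum (ζ : L × L) {n d : ℕ} (e : Fin d → Cx L) (x : Fin n → Fin d → ℂ) :
    S.prodCorr ζ (fun k => ∑ a, x k a • e a) = (-Complex.I) ^ n *
      iteratedFDeriv ℂ n (fun u : Fin d → ℂ => S.weylCorr ζ (∑ a, u a • e a)) 0 x := by
  set f : (Fin d → ℂ) → ℂ := fun u => S.weylCorr ζ (∑ a, u a • e a) with hf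
  have hfc : ContDiff ℂ n f := S.contDiff_weylCorr ζ e n
  let g : (Fin n → ℝ) →L[ℝ] (Fin d → ℂ) :=
    LinearMap.toContinuousLinearMap (Fintype.linearCombination ℝ x)
  have hg : ∀ t, g t = ∑ k, t k • x k := fun t => Fintype.linearCombination_apply ℝ x t
  have hcomp : (fun t : Fin n → ℝ => S.weylCorr ζ (∑ k, (t k : ℂ) • ∑ a, x k a • e a))
      = f ∘ g := by
    funext t
    simp only [Function.comp_apply, hf, hg]
    congr 1
    simp only [Finset.smul_sum, Finset.sum_apply, Pi.smul_apply, Finset.sum_smul]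
    rw [Finset.sum_comm]
    refine Finset.sum_congr rfl fun a _ => Finset.sum_congr rfl fun k _ => ?_
    rw [smul_smul, Complex.real_smul]
  rw [prodCorr, hcomp, g.iteratedFDeriv_comp_right (hfc.restrict_scalars ℝ) 0 le_rfl, map_zero,
    ← ContDiffAt.restrictScalars_iteratedFDeriv (𝕜 := ℝ) hfc.contDiffAt]
  congr 1
  simp only [ContinuousMultilinearMap.compContinuousLinearMap_apply, Function.comp_apply,
    ContinuousMultilinearMap.coe_restrictScalars]
  congr 1
  funext k
  rw [hg]
  simp [Pi.single_apply]

/-- On `L^-` the Gaussian exponent is a multiple of `ω(ξ, ξ) = 0`. What remains is the exponential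
of a linear form, whose mixed derivative at `0` is the product of its values. -/
theorem prodCorr_of_mem_Lminus (ζ : L × L) {n : ℕ} {ξ : Fin n → Cx L} (hξ : ∀ k, ξ k ∈ S.Lminus) :
    S.prodCorr ζ ξ = S.amplitude ζ * ∏ k, S.linObs (ξ k) (S.hatAvg ζ) := by
  have hξe : ξ = fun k => ∑ a, (Pi.single k 1 : Fin n → ℂ) a • ξ a := by
    funext k
    simp [Pi.single_apply]
  conv_lhs => rw [hξe]
  rw [prodCorr_sum]
  let g : (Fin n → ℂ) →L[ℂ] ℂ := LinearMap.toContinuousLinearMap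
    (Fintype.linearCombination ℂ fun a => Complex.I * S.linObs (ξ a) (S.hatAvg ζ))
  have hg : ∀ t, g t = ∑ k, t k • (Complex.I * S.linObs (ξ k) (S.hatAvg ζ)) :=
    fun t => Fintype.linearCombination_apply ℂ _ t
  have hf : (fun u : Fin n → ℂ => S.weylCorr ζ (∑ a, u a • ξ a))
      = S.amplitude ζ • (Complex.exp ∘ g) := by
    funext u
    have hu : ∑ a, u a • ξ a ∈ S.Lminus :=
      Submodule.sum_mem _ fun a _ => Submodule.smul_mem _ _ (hξ a)
    rw [weylCorr_eq, S.mem_Lminus.mp hu, map_smul, ωC_alt, linObs_sum_left]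
    simp only [Pi.smul_apply, Function.comp_apply, hg, smul_eq_mul, Finset.mul_sum, mul_zero,
      sub_zero]
    congr 2
    exact Finset.sum_congr rfl fun _ _ => by ring
  have hexp : ContDiff ℂ n Complex.exp := Complex.contDiff_exp
  rw [hf, iteratedFDeriv_const_smul_apply (hexp.comp g.contDiff).contDiffAt,
    g.iteratedFDeriv_comp_right hexp 0 le_rfl, map_zero]
  simp only [smul_apply,
    ContinuousMultilinearMap.compContinuousLinearMap_apply,
    iteratedFDeriv_apply_eq_iteratedDeriv_mul_prod, hg]
  have hder : iteratedDeriv n Complex.exp 0 = 1 := by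
    rw [iteratedDeriv_eq_iterate, Complex.iter_deriv_exp, Complex.exp_zero]
  have hsingle : ∀ k : Fin n, ∑ a, (Pi.single k 1 : Fin n → ℂ) a *
      (Complex.I * S.linObs (ξ a) (S.hatAvg ζ)) = Complex.I * S.linObs (ξ k) (S.hatAvg ζ) :=
    fun k => by simp [Pi.single_apply]
  simp only [hder, hsingle, smul_eq_mul, mul_one, Finset.prod_mul_distrib, Finset.prod_const,
    Finset.card_univ, Fintype.card_fin]
  have hI : (-Complex.I) ^ n * Complex.I ^ n = 1 := by
    rw [← mul_pow]; simp
  linear_combination (S.amplitude ζ * ∏ k, S.linObs (ξ k) (S.hatAvg ζ)) * hI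

end KahlerPhaseSpace

theorem Submodule.eq_sum_repr_smul {K M ι : Type*} [Ring K] [AddCommGroup M] [Module K M]
    [Fintype ι] {W : Submodule K M} (e : Module.Basis ι K W) {x : M} (hx : x ∈ W) :
    x = ∑ a, e.repr ⟨x, hx⟩ a • (e a : M) := by
  have := congrArg W.subtype (e.sum_repr ⟨x, hx⟩)
  rw [map_sum] at this
  exact this.symm

namespace KahlerPhaseSpace

variable {L : Type*} [AddCommGroup L] [Module ℝ L] (S : KahlerPhaseSpace L)

/-! ### Finitely many modes and independence of the decomposition -/

section Modes

variable {S} (V : S.FiniteModes)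

theorem finite_modes : Module.Finite ℂ (V.1.baseChange ℂ) := by
  have := V.2.1
  exact Module.Finite.of_surjective _ (V.1.toBaseChange_surjective ℂ)

theorem toCx_mem_modes {x : L} (hx : x ∈ V.1) : toCx x ∈ V.1.baseChange ℂ :=
  Submodule.tmul_mem_baseChange_of_mem _ hx

theorem JC_mem_modes {x : Cx L} (hx : x ∈ V.1.baseChange ℂ) : S.JC x ∈ V.1.baseChange ℂ := by
  obtain ⟨a, ha, b, hb, rfl⟩ := Cx.exists_re_im_of_mem hx
  rw [map_add, map_smul, JC_toCx, JC_toCx]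
  exact Submodule.add_mem _ (toCx_mem_modes V (V.2.2 a ha))
    (Submodule.smul_mem _ _ (toCx_mem_modes V (V.2.2 b hb)))

theorem Pplus_mem_modes {x : Cx L} (hx : x ∈ V.1.baseChange ℂ) : S.Pplus x ∈ V.1.baseChange ℂ :=
  Submodule.smul_mem _ _ (Submodule.sub_mem _ hx (Submodule.smul_mem _ _ (JC_mem_modes V hx)))

theorem Pminus_mem_modes {x : Cx L} (hx : x ∈ V.1.baseChange ℂ) :
    S.Pminus x ∈ V.1.baseChange ℂ :=
  Submodule.smul_mem _ _ (Submodule.add_mem _ hx (Submodule.smul_mem _ _ (JC_mem_modes V hx)))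

theorem hatAvg_mem_modes {τ φ : L} (hτ : τ ∈ V.1) (hφ : φ ∈ V.1) :
    S.hatAvg (τ, φ) ∈ V.1.baseChange ℂ := by
  rw [hatAvg_eq]
  exact Submodule.add_mem _ (Pplus_mem_modes V (toCx_mem_modes V hφ))
    (Pminus_mem_modes V (toCx_mem_modes V hτ))

/-- The symplectic form is non-degenerate on finitely many modes. -/
theorem eq_zero_of_linObs_modes {φ : Cx L} (hφ : φ ∈ V.1.baseChange ℂ)
    (h : ∀ ξ ∈ V.1.baseChange ℂ, S.linObs ξ φ = 0) : φ = 0 := by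
  obtain ⟨a, ha, b, hb, rfl⟩ := Cx.exists_re_im_of_mem hφ
  have key : ∀ x ∈ V.1, S.ω x a = 0 ∧ S.ω x b = 0 := by
    intro x hx
    have h0 := h (toCx x) (toCx_mem_modes V hx)
    rw [linObs, map_add, map_smul, ωC_toCx, ωC_toCx, mul_eq_zero, or_iff_right two_ne_zero] at h0
    have h1 := congrArg Complex.re h0
    have h2 := congrArg Complex.im h0
    simp at h1 h2
    exact ⟨h1, h2⟩
  have hzero : ∀ y ∈ V.1, (∀ x ∈ V.1, S.ω x y = 0) → y = 0 := by
    intro y hy hxy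
    by_contra hne
    have := S.pos y hne
    rw [S.skew, hxy _ (V.2.2 y hy), neg_zero] at this
    exact lt_irrefl _ this
  rw [hzero a ha fun x hx => (key x hx).1, hzero b hb fun x hx => (key x hx).2]
  simp [toCx]

/-- Coordinates on finitely many modes given by linear observables. -/
theorem exists_linObs_coordinates : ∃ (d : ℕ) (e : Module.Basis (Fin d) ℂ (V.1.baseChange ℂ))
    (Θ : V.1.baseChange ℂ ≃ₗ[ℂ] (Fin d → ℂ)), ∀ φ a, Θ φ a = S.linObs (e a) φ := by
  have := finite_modes V
  let e := Module.finBasis ℂ (V.1.baseChange ℂ)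
  let Θ : V.1.baseChange ℂ →ₗ[ℂ] (Fin (Module.finrank ℂ (V.1.baseChange ℂ)) → ℂ) :=
    LinearMap.pi fun a => (2 : ℂ) • (S.ωC (e a)).comp (V.1.baseChange ℂ).subtype
  have hΘ : ∀ φ a, Θ φ a = S.linObs (e a) φ := fun φ a => rfl
  have hinj : Function.Injective Θ := by
    rw [← LinearMap.ker_eq_bot, LinearMap.ker_eq_bot']
    intro φ hφ
    refine Subtype.ext (eq_zero_of_linObs_modes V φ.2 fun ξ hξ => ?_)
    rw [Submodule.eq_sum_repr_smul e hξ, linObs_sum_left]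
    refine Finset.sum_eq_zero fun a _ => ?_
    rw [← hΘ, hφ, Pi.zero_apply, mul_zero]
  refine ⟨_, e, LinearEquiv.ofInjectiveOfFinrankEq Θ hinj (by simp), fun φ a => ?_⟩
  exact hΘ φ a

/-- The symmetric tensor underlying a linear combination of products of linear observables, and hence
the correlation function, is determined by the function. -/
theorem sum_prodCorr_eq (ζ : L × L) {n N : ℕ} (c : Fin N → ℂ) {ξ η : Fin N → Fin n → Cx L}
    (hξ : ∀ j k, ξ j k ∈ V.1.baseChange ℂ) (hη : ∀ j k, η j k ∈ V.1.baseChange ℂ)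
    (h : ∀ φ ∈ V.1.baseChange ℂ,
      ∑ j, c j * ∏ k, S.linObs (ξ j k) φ = ∑ j, c j * ∏ k, S.linObs (η j k) φ) :
    ∑ j, c j * S.prodCorr ζ (ξ j) = ∑ j, c j * S.prodCorr ζ (η j) := by
  obtain ⟨d, e, Θ, hΘ⟩ := exists_linObs_coordinates V
  let f : (Fin d → ℂ) → ℂ := fun u => S.weylCorr ζ (∑ a, u a • (e a : Cx L))
  let M := (iteratedFDeriv ℂ n f 0).toMultilinearMap
  have hcorr : ∀ {x : Fin n → Cx L} (hx : ∀ k, x k ∈ V.1.baseChange ℂ),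
      S.prodCorr ζ x = (-Complex.I) ^ n * M fun k a => e.repr ⟨x k, hx k⟩ a := fun {x} hx => by
    conv_lhs => rw [show x = fun k => ∑ a, e.repr ⟨x k, hx k⟩ a • (e a : Cx L) from
      funext fun k => Submodule.eq_sum_repr_smul e (hx k)]
    exact S.prodCorr_sum ζ (fun a => (e a : Cx L)) fun k a => e.repr ⟨x k, hx k⟩ a
  have hobs : ∀ {x : Cx L} (hx : x ∈ V.1.baseChange ℂ) (y : Fin d → ℂ),
      ∑ a, e.repr ⟨x, hx⟩ a * y a = S.linObs x (Θ.symm y) := fun {x} hx y => by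
    conv_rhs => rw [Submodule.eq_sum_repr_smul e hx, linObs_sum_left]
    refine Finset.sum_congr rfl fun a _ => ?_
    rw [← hΘ, LinearEquiv.apply_symm_apply]
  -- The two decompositions are joined into one, with opposite signs, representing the zero
  -- polynomial.
  have hzero := sum_symmetric_eq_zero M
    (fun x σ => (S.contDiff_weylCorr ζ _ ⊤).contDiffAt.iteratedFDeriv_comp_perm x σ)
    Finset.univ (Sum.elim c (-c))
    (Sum.elim (fun j k a => e.repr ⟨ξ j k, hξ j k⟩ a) fun j k a => e.repr ⟨η j k, hη j k⟩ a)
    fun y => by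
      simp only [Fintype.sum_sum_type, Sum.elim_inl, Sum.elim_inr, hobs, Pi.neg_apply, neg_mul,
        Finset.sum_neg_distrib]
      rw [h _ (Θ.symm y).2, add_neg_cancel]
  simp only [Fintype.sum_sum_type, Sum.elim_inl, Sum.elim_inr, Pi.neg_apply, neg_mul,
    Finset.sum_neg_distrib] at hzero
  simp only [fun j => hcorr (hξ j), fun j => hcorr (hη j), mul_left_comm (c _)]
  rw [← Finset.mul_sum, ← Finset.mul_sum, eq_of_sub_eq_zero ((sub_eq_add_neg _ _).trans hzero)]

end Modes

theorem homComponent_eq_lineCoeff (F : Cx L → ℂ) : homComponent F = lineCoeff F 0 := by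
  funext n φ
  simp [homComponent, lineCoeff]

/-! ### Correlation functions of holomorphic observables -/

section Holomorphic

variable {S} {F : Cx L → ℂ}

theorem apply_Pplus (hinv : ∀ φ : Cx L, ∀ ξ ∈ S.Lminus, F φ = F (φ + ξ)) (φ : Cx L) :
    F (S.Pplus φ) = F φ := by
  rw [hinv _ _ (S.Pminus_mem_Lminus φ), S.Pplus_add_Pminus]

theorem homComponent_add (hinv : ∀ φ : Cx L, ∀ ξ ∈ S.Lminus, F φ = F (φ + ξ)) (n : ℕ)
    (φ : Cx L) {ξ : Cx L} (hξ : ξ ∈ S.Lminus) :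
    homComponent F n φ = homComponent F n (φ + ξ) := by
  have : (fun z : ℂ => F (z • φ)) = fun z : ℂ => F (z • (φ + ξ)) := by
    funext z
    rw [smul_add]
    exact hinv _ _ (S.Lminus.smul_mem z hξ)
  rw [homComponent, homComponent, this]

theorem apply_hatAvg (hinv : ∀ φ : Cx L, ∀ ξ ∈ S.Lminus, F φ = F (φ + ξ)) (τ φ : L) :
    F (S.hatAvg (τ, φ)) = F (toCx φ) := by
  rw [hatAvg_eq, ← hinv _ _ (S.Pminus_mem_Lminus _), apply_Pplus hinv]

theorem isHomCorr_iff (hF : IsLineHolomorphic F)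
    (hinv : ∀ φ : Cx L, ∀ ξ ∈ S.Lminus, F φ = F (φ + ξ)) (V : S.FiniteModes) {τ φ : L}
    (hτ : τ ∈ V.1) (hφ : φ ∈ V.1) (n : ℕ) (r : ℂ) :
    S.IsHomCorr F V n (τ, φ) r ↔
      r = S.amplitude (τ, φ) * homComponent F n (S.hatAvg (τ, φ)) := by
  have hmem : S.hatAvg (τ, φ) ∈ V.1.baseChange ℂ := hatAvg_mem_modes V hτ hφ
  have value : ∀ {N : ℕ} {c : Fin N → ℂ} {ξ : Fin N → Fin n → Cx L},
      (∀ j k, ξ j k ∈ V.1.baseChange ℂ) →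
      (∀ x ∈ V.1.baseChange ℂ, homComponent F n x = ∑ j, c j * ∏ k, S.linObs (ξ j k) x) →
      ∑ j, c j * S.prodCorr (τ, φ) (ξ j)
        = S.amplitude (τ, φ) * homComponent F n (S.hatAvg (τ, φ)) := by
    intro N c ξ hξ h
    -- Invariance allows evaluation at `P^+ x`, which moves every factor of the given decomposition
    -- into `L^-`.
    have hP : ∀ x ∈ V.1.baseChange ℂ,
        homComponent F n x = ∑ j, c j * ∏ k, S.linObs (S.Pminus (ξ j k)) x := fun x hx => by
      simp only [linObs_Pminus_left]
      rw [← h _ (Pplus_mem_modes V hx), homComponent_add hinv n (S.Pplus x) (S.Pminus_mem_Lminus x),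
        S.Pplus_add_Pminus]
    rw [sum_prodCorr_eq V (τ, φ) c hξ (fun j k => Pminus_mem_modes V (hξ j k))
      fun x hx => (h x hx).symm.trans (hP x hx), hP _ hmem, Finset.mul_sum]
    refine Finset.sum_congr rfl fun j _ => ?_
    rw [prodCorr_of_mem_Lminus _ _ fun k => S.Pminus_mem_Lminus (ξ j k)]
    ring
  constructor
  · rintro ⟨N, c, ξ, hξ, h, rfl⟩
    exact value hξ h
  · rintro rfl
    obtain ⟨d, e, Θ, hΘ⟩ := exists_linObs_coordinates V
    obtain ⟨N, c, α, h⟩ := exists_sum_prod_of_homogeneous (n := n)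
      (f := fun y => homComponent F n (Θ.symm y)) (fun a b => by
        obtain ⟨p, hp, hz⟩ := isLinePolynomial_lineCoeff hF 0 n (Θ.symm a : Cx L) (Θ.symm b)
        refine ⟨p, hp, fun z => ?_⟩
        rw [← hz z, homComponent_eq_lineCoeff]
        simp only [map_add, map_smul, Submodule.coe_add, Submodule.coe_smul]) (fun w x => by
        rw [homComponent_eq_lineCoeff, map_smul]
        exact lineCoeff_smul hF 0 _ n w)
    have hrep : ∀ x ∈ V.1.baseChange ℂ,
        homComponent F n x = ∑ j, c j * ∏ k, S.linObs (e (α j k)) x := fun x hx => by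
      have := h (Θ ⟨x, hx⟩)
      simpa only [LinearEquiv.symm_apply_apply, hΘ] using this
    exact ⟨N, c, fun j k => e (α j k), fun j k => (e (α j k)).2, hrep,
      (value (fun j k => (e (α j k)).2) hrep).symm⟩

theorem isModeCorr_iff (hF : IsLineHolomorphic F)
    (hinv : ∀ φ : Cx L, ∀ ξ ∈ S.Lminus, F φ = F (φ + ξ)) (V : S.FiniteModes) {τ φ : L}
    (hτ : τ ∈ V.1) (hφ : φ ∈ V.1) (r : ℂ) :
    S.IsModeCorr F V (τ, φ) r ↔ r = F (toCx φ) * S.coh τ φ := by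
  have hsum : HasSum (fun n => S.amplitude (τ, φ) * homComponent F n (S.hatAvg (τ, φ)))
      (F (toCx φ) * S.coh τ φ) := by
    -- The Taylor series at `0` towards the averaged solution, summed at parameter `1`.
    have h := (hasSum_lineCoeff hF 0 (S.hatAvg (τ, φ)) 1).mul_left (S.amplitude (τ, φ))
    simpa only [one_pow, one_mul, one_smul, zero_add, apply_hatAvg hinv, amplitude_eq,
      homComponent_eq_lineCoeff, mul_comm (F _)] using h
  constructor
  · rintro ⟨s, hs, hr⟩
    have : s = fun n => S.amplitude (τ, φ) * homComponent F n (S.hatAvg (τ, φ)) :=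
      funext fun n => (isHomCorr_iff hF hinv V hτ hφ n _).mp (hs n)
    rw [this] at hr
    exact hr.unique hsum
  · rintro rfl
    exact ⟨_, fun n => (isHomCorr_iff hF hinv V hτ hφ n _).mpr rfl, hsum⟩

theorem directed_modes (V W : S.FiniteModes) : ∃ U : S.FiniteModes, V ≤ U ∧ W ≤ U := by
  have := V.2.1
  have := W.2.1
  refine ⟨⟨V.1 ⊔ W.1, inferInstance, fun x hx => ?_⟩, le_sup_left (a := V.1), le_sup_right (b := W.1)⟩
  obtain ⟨a, ha, b, hb, rfl⟩ := Submodule.mem_sup.mp hx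
  rw [map_add]
  exact Submodule.add_mem_sup (V.2.2 a ha) (W.2.2 b hb)

theorem exists_modes_mem (x : L) : ∃ V : S.FiniteModes, x ∈ V.1 := by
  refine ⟨⟨Submodule.span ℝ {x, S.J x}, FiniteDimensional.span_of_finite ℝ (by simp),
    fun y hy => ?_⟩, Submodule.subset_span (by simp)⟩
  obtain ⟨a, b, rfl⟩ := Submodule.mem_span_pair.mp hy
  exact Submodule.mem_span_pair.mpr ⟨-b, a, by simp [S.J_sq]; abel⟩

instance neBot_atTop_modes : (Filter.atTop : Filter S.FiniteModes).NeBot := by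
  have : IsDirectedOrder S.FiniteModes := ⟨directed_modes⟩
  have : Nonempty S.FiniteModes := ⟨(exists_modes_mem (S := S) 0).choose⟩
  exact Filter.atTop_neBot

theorem eventually_mem_modes (x : L) : ∀ᶠ V : S.FiniteModes in Filter.atTop, x ∈ V.1 := by
  obtain ⟨V, hV⟩ := exists_modes_mem (S := S) x
  filter_upwards [Filter.eventually_ge_atTop V] with W hW
  exact hW hV

/-- The value is the same for all modes containing `τ` and `φ`, so the net is eventually constant;
its limit is unique since the modes are directed. -/
theorem isCorr_iff (hF : IsLineHolomorphic F)
    (hinv : ∀ φ : Cx L, ∀ ξ ∈ S.Lminus, F φ = F (φ + ξ)) (τ φ : L) (r : ℂ) :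
    S.IsCorr F (τ, φ) r ↔ r = F (toCx φ) * S.coh τ φ := by
  constructor
  · rintro ⟨s, hs, hr⟩
    refine tendsto_nhds_unique hr (tendsto_const_nhds.congr' ?_)
    filter_upwards [hs, eventually_mem_modes τ, eventually_mem_modes φ] with V h hτ hφ
    exact ((isModeCorr_iff hF hinv V hτ hφ _).mp h).symm
  · rintro rfl
    refine ⟨fun _ => F (toCx φ) * S.coh τ φ, ?_, tendsto_const_nhds⟩
    filter_upwards [eventually_mem_modes τ, eventually_mem_modes φ] with V hτ hφ
    exact (isModeCorr_iff hF hinv V hτ hφ _).mpr rfl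

end Holomorphic

/-! ### The multiplication operator and its uniqueness -/

/-- Multiplication of wave functions by `F`. -/
noncomputable def mulOperator (F : Cx L → ℂ) : S.StateSpace →ₗ[ℂ] (L → ℂ) where
  toFun ψ φ := F (toCx φ) * ψ φ
  map_add' a b := by
    funext φ
    simp [mul_add]
  map_smul' c a := by
    funext φ
    simp [mul_left_comm]

/-- Continuous linear functionals agree if they agree on the coherent states. -/
theorem eq_of_eq_on_coh {f g : S.StateSpace →ₗ[ℂ] ℂ} (hf : Continuous f) (hg : Continuous g)
    (h : ∀ τ, f (S.coh τ) = g (S.coh τ)) : f = g := by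
  have hd := RKHS.kerFun_dense (H := S.StateSpace)
  have hle : Submodule.span ℂ {RKHS.kerFun S.StateSpace x v | (x) (v)} ≤ LinearMap.eqLocus f g := by
    rw [Submodule.span_le]
    rintro _ ⟨x, v, rfl⟩
    have : RKHS.kerFun S.StateSpace x v = v • S.coh x := by
      rw [coh, ← map_smul, smul_eq_mul, mul_one]
    rw [this]
    simp [LinearMap.mem_eqLocus, h]
  have hcl : IsClosed (LinearMap.eqLocus f g : Set S.StateSpace) := isClosed_eq hf hg
  refine LinearMap.ext fun ψ => ?_
  have hψ : ψ ∈ (Submodule.span ℂ {RKHS.kerFun S.StateSpace x v | (x) (v)}).topologicalClosure := by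
    rw [hd]; trivial
  exact (Submodule.topologicalClosure_minimal _ hle hcl) hψ

theorem isQuantization_iff {F : Cx L → ℂ} (hF : IsLineHolomorphic F)
    (hinv : ∀ φ : Cx L, ∀ ξ ∈ S.Lminus, F φ = F (φ + ξ)) (T : S.StateSpace →ₗ[ℂ] (L → ℂ)) :
    S.IsQuantization F T ↔ T = S.mulOperator F := by
  have hc : ∀ φ : L, Continuous fun ψ => S.mulOperator F ψ φ := fun φ =>
    continuous_const.mul (RKHS.continuous_eval φ)
  constructor
  · intro hT
    refine LinearMap.ext fun ψ => funext fun φ => ?_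
    refine LinearMap.congr_fun (S.eq_of_eq_on_coh (f := (LinearMap.proj φ).comp T)
      (g := (LinearMap.proj φ).comp (S.mulOperator F)) (hT.continuous φ) (hc φ) fun τ => ?_) ψ
    exact (isCorr_iff hF hinv τ φ _).mp (hT.corr τ φ)
  · rintro rfl
    exact ⟨fun τ φ => (isCorr_iff hF hinv τ φ _).mpr rfl, hc⟩

end KahlerPhaseSpace

theorem proposition4p4 {L : Type*} [AddCommGroup L] [Module ℝ L] (S : KahlerPhaseSpace L)
    (F : Cx L → ℂ) (hF : IsLineHolomorphic F)
    (hinv : ∀ φ : Cx L, ∀ ξ ∈ S.Lminus, F φ = F (φ + ξ)) :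
    (∃! T : S.StateSpace →ₗ[ℂ] (L → ℂ), S.IsQuantization F T) ∧
    ∀ T : S.StateSpace →ₗ[ℂ] (L → ℂ), S.IsQuantization F T →
      (∀ (ψ : S.StateSpace) (φ : L), T ψ φ = F (toCx φ) * ψ φ) ∧
      (∀ ψ : S.StateSpace, ψ ∈ (S.toOperator T).domain ↔
        ∃ χ : S.StateSpace, ∀ φ : L, χ φ = F (toCx φ) * ψ φ) ∧
      (∀ (ψ : (S.toOperator T).domain) (φ : L),
        (S.toOperator T ψ : S.StateSpace) φ = F (toCx φ) * (ψ : S.StateSpace) φ) := by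
  refine ⟨⟨S.mulOperator F, (S.isQuantization_iff hF hinv _).mpr rfl,
    fun T hT => (S.isQuantization_iff hF hinv T).mp hT⟩, fun T hT => ?_⟩
  obtain rfl := (S.isQuantization_iff hF hinv T).mp hT
  exact ⟨fun _ _ => rfl, fun _ => Iff.rfl, fun ψ φ => S.toOperator_apply _ ψ φ⟩
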